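/- A metric measure space $(X,d,\mu)$ is a non-empty complete metric space with a Borel measure; write $B(x,r)$ for the open ball. It is \emph{1-uniform} if $\mu(B(x,r))=r$ for all $x\in X$ and $r>0$. Let $\mathcal H^1$ denote one-dimensional Hausdorff measure and consider the following three metric measure spaces: - $\mathbb R$ with its usual metric and the measure $\tfrac12\mathcal H^1$; - $\mathcal S=\{s\in\{0,1\}^{\mathbb Z}: s_i=0\text{ for all sufficiently large } i\}$ with the metric $d(s,t)=\sum_{i\in\mathbb Z}2^i|s_i-t_i|$ and the measure $\mathcal H^1$; - $\mathcal T=\mathbb R/2\mathbb Z\times F$, where $F$ is the set of sequences $s=(s_0,s_1,s_2,\dots)$ in $\{0,1\}$ with only finitely many non-zero terms, with the metric $d((x,s),(y,t))=d_{\mathbb R/2\mathbb Z}(x,y)+\sum_{i\ge 0}2^i|s_i-t_i|$ and the measure $\tfrac12\mathcal H^1$. For $c>0$, the scaled copy of $(Y,d,\nu)$ by the factor $c$ is $(Y,c\,d,c\,\nu)$. A \emph{Besicovitch pair} in a metric space is a pair of distinct points $a,b$ such that $d(x,y)\ge d(a,b)$ for all $x\in B(a,d(a,b))$ and $y\in B(b,d(a,b))$.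 **Theorem 1.2.** Let $(X,d,\mu)$ be a 1-uniform metric measure space. Then there is a measure-preserving surjective isometry between $X$ and a scaled copy of $\mathbb R$, of $\mathcal S$ or of $\mathcal T$. Moreover: 1. If $X$ is connected, then there is a measure-preserving surjective isometry from $X$ to $\mathbb R$. 2. If $X$ is disconnected, then $X$ contains a Besicovitch pair. 3. For every Besicovitch pair $a,b$ in $X$, with $\delta=d(a,b)$ and $C(a,\delta)$ the closure of $B(a,\delta)$, the metric space $X$ is isometric to $C(a,\delta)\times F$ with the metric $((x,s),(y,t))\mapsto d(x,y)+\delta\sum_{i\ge 0}2^i|s_i-t_i|$. -/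

import Mathlib

open MeasureTheory Metric
open scoped ENNReal

/-- The measure `μ` is 1-uniform: the open ball of radius `r` about any point has measure `r`. -/
def IsOneUniform {X : Type*} [MetricSpace X] [MeasurableSpace X] (μ : Measure X) : Prop :=
  ∀ (x : X) (r : ℝ), 0 < r → μ (ball x r) = ENNReal.ofReal r

/-- `(X, d, μ)` is isometric, as a metric measure space, to the scaled copy
`(Y, c • d_Y, c • ν)` of `(Y, d_Y, ν)` for some `c > 0`. -/
def IsScaledCopy {X Y : Type*} [MetricSpace X] [MeasurableSpace X] [MetricSpace Y]
    [MeasurableSpace Y] (μ : Measure X) (ν : Measure Y) : Prop :=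
  ∃ c : ℝ, 0 < c ∧ ∃ e : Y ≃ X, (∀ p q : Y, dist (e p) (e q) = c * dist p q) ∧
    μ = ENNReal.ofReal c • ν.map e

/-- A Besicovitch pair: two distinct points `a`, `b` such that the open balls of radius `d(a,b)`
about them are at distance at least `d(a,b)`. -/
def IsBesicovitchPair {X : Type*} [MetricSpace X] (a b : X) : Prop :=
  a ≠ b ∧ ∀ x ∈ ball a (dist a b), ∀ y ∈ ball b (dist a b), dist a b ≤ dist x y

/-- The numerical value, `0` or `1`, of a binary digit. -/
def digit (b : Bool) : ℝ := if b then 1 else 0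

/-- The weighted `ℓ₁` distance `∑ᵢ 2ⁱ |sᵢ - tᵢ|` of two families of binary digits, the exponents
being given by `k`. -/
noncomputable def digitDist {ι : Type*} (k : ι → ℤ) (s t : ι → Bool) : ℝ :=
  ∑' i, (2 : ℝ) ^ k i * |digit (s i) - digit (t i)|

lemma digit_injective : Function.Injective digit := by
  intro a b h
  cases a <;> cases b <;> simp_all [digit]

lemma digitDist_term_nonneg {ι : Type*} (k : ι → ℤ) (s t : ι → Bool) (i : ι) :
    0 ≤ (2 : ℝ) ^ k i * |digit (s i) - digit (t i)| := by positivity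

lemma digitDist_self {ι : Type*} (k : ι → ℤ) (s : ι → Bool) : digitDist k s s = 0 := by
  simp [digitDist]

lemma digitDist_comm {ι : Type*} (k : ι → ℤ) (s t : ι → Bool) :
    digitDist k s t = digitDist k t s := by
  simp only [digitDist, abs_sub_comm]

lemma digitDist_triangle {ι : Type*} (k : ι → ℤ) (s t u : ι → Bool)
    (hst : Summable fun i => (2 : ℝ) ^ k i * |digit (s i) - digit (t i)|)
    (htu : Summable fun i => (2 : ℝ) ^ k i * |digit (t i) - digit (u i)|)
    (hsu : Summable fun i => (2 : ℝ) ^ k i * |digit (s i) - digit (u i)|) :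
    digitDist k s u ≤ digitDist k s t + digitDist k t u := by
  unfold digitDist
  rw [← hst.tsum_add htu]
  refine hsu.tsum_le_tsum (fun i => ?_) (hst.add htu)
  rw [← mul_add]
  exact mul_le_mul_of_nonneg_left (abs_sub_le _ _ _) (by positivity)

lemma eq_of_digitDist_eq_zero {ι : Type*} (k : ι → ℤ) (s t : ι → Bool)
    (hst : Summable fun i => (2 : ℝ) ^ k i * |digit (s i) - digit (t i)|)
    (h : digitDist k s t = 0) : s = t := by
  funext i
  have h0 : HasSum (fun i => (2 : ℝ) ^ k i * |digit (s i) - digit (t i)|) 0 := h ▸ hst.hasSum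
  have h1 := congrFun ((hasSum_zero_iff_of_nonneg (digitDist_term_nonneg k s t)).1 h0) i
  have h2 : (2 : ℝ) ^ k i ≠ 0 := by positivity
  have h3 : |digit (s i) - digit (t i)| = 0 := by
    rcases mul_eq_zero.1 h1 with h | h
    · exact absurd h h2
    · exact h
  exact digit_injective (sub_eq_zero.1 (abs_eq_zero.1 h3))

/-- The points of the dyadic space `𝒮`: two-sided binary sequences `(sᵢ)`, `i ∈ ℤ`, that vanish
for all sufficiently large `i`. -/
@[ext]
structure DyadicSpace where
  /-- the digits of the point -/
  val : ℤ → Bool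
  eventually_zero : ∃ n : ℕ, ∀ i : ℤ, (n : ℤ) ≤ i → val i = false

lemma DyadicSpace.summable (s t : DyadicSpace) :
    Summable fun i : ℤ => (2 : ℝ) ^ i * |digit (s.val i) - digit (t.val i)| := by
  obtain ⟨n, hn⟩ := s.eventually_zero
  obtain ⟨m, hm⟩ := t.eventually_zero
  apply Summable.of_nat_of_neg
  · apply summable_of_ne_finset_zero (s := Finset.range (max n m))
    intro j hj
    have hj' : max n m ≤ j := by simpa using hj
    rw [hn j (by exact_mod_cast (le_max_left n m).trans hj'),
      hm j (by exact_mod_cast (le_max_right n m).trans hj')]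
    simp
  · refine Summable.of_nonneg_of_le (fun j => by positivity) (fun j => ?_)
      (summable_geometric_of_lt_one (r := (1 / 2 : ℝ)) (by norm_num) (by norm_num))
    have h1 : |digit (s.val (-(j : ℤ))) - digit (t.val (-(j : ℤ)))| ≤ 1 := by
      cases s.val (-(j : ℤ)) <;> cases t.val (-(j : ℤ)) <;> simp [digit]
    calc (2 : ℝ) ^ (-(j : ℤ)) * |digit (s.val (-(j : ℤ))) - digit (t.val (-(j : ℤ)))|
        ≤ (2 : ℝ) ^ (-(j : ℤ)) * 1 := mul_le_mul_of_nonneg_left h1 (by positivity)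
      _ = (1 / 2 : ℝ) ^ j := by simp

/-- The metric `d(s,t) = ∑_{i ∈ ℤ} 2ⁱ |sᵢ - tᵢ|` of the dyadic space. -/
noncomputable instance : MetricSpace DyadicSpace where
  dist s t := digitDist (fun i : ℤ => i) s.val t.val
  dist_self s := digitDist_self _ _
  dist_comm s t := digitDist_comm _ _ _
  dist_triangle s t u :=
    digitDist_triangle _ _ _ _ (s.summable t) (t.summable u) (s.summable u)
  eq_of_dist_eq_zero h := DyadicSpace.ext (eq_of_digitDist_eq_zero _ _ _ (DyadicSpace.summable _ _) h)

noncomputable instance : MeasurableSpace DyadicSpace := borel _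

instance : BorelSpace DyadicSpace := ⟨rfl⟩

lemma DyadicSpace.dist_def (s t : DyadicSpace) :
    dist s t = ∑' i : ℤ, (2 : ℝ) ^ i * |digit (s.val i) - digit (t.val i)| := rfl

/-- One-sided binary sequences `(sᵢ)`, `i = 0, 1, 2, …`, with only finitely many digits `1`. -/
@[ext]
structure BinarySeq where
  /-- the digits of the sequence -/
  val : ℕ → Bool
  eventually_zero : ∃ n : ℕ, ∀ i : ℕ, n ≤ i → val i = false

lemma BinarySeq.summable (s t : BinarySeq) :
    Summable fun i : ℕ => (2 : ℝ) ^ (i : ℤ) * |digit (s.val i) - digit (t.val i)| := by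
  obtain ⟨n, hn⟩ := s.eventually_zero
  obtain ⟨m, hm⟩ := t.eventually_zero
  apply summable_of_ne_finset_zero (s := Finset.range (max n m))
  intro j hj
  have hj' : max n m ≤ j := by simpa using hj
  rw [hn j ((le_max_left n m).trans hj'), hm j ((le_max_right n m).trans hj')]
  simp

/-- The metric `d(s,t) = ∑_{i ≥ 0} 2ⁱ |sᵢ - tᵢ|` on finite binary sequences. -/
noncomputable instance : MetricSpace BinarySeq where
  dist s t := digitDist (fun i : ℕ => (i : ℤ)) s.val t.val
  dist_self s := digitDist_self _ _
  dist_comm s t := digitDist_comm _ _ _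
  dist_triangle s t u :=
    digitDist_triangle _ _ _ _ (s.summable t) (t.summable u) (s.summable u)
  eq_of_dist_eq_zero h := BinarySeq.ext (eq_of_digitDist_eq_zero _ _ _ (BinarySeq.summable _ _) h)

lemma BinarySeq.dist_def (s t : BinarySeq) :
    dist s t = ∑' i : ℕ, (2 : ℝ) ^ i * |digit (s.val i) - digit (t.val i)| := by
  change digitDist _ _ _ = _
  simp [digitDist]

/-- The points of the space `𝒯`: a circle `ℝ/2ℤ` at each finite binary sequence. -/
@[ext]
structure CircleSpace where
  /-- the position on the circle -/
  pt : AddCircle (2 : ℝ)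
  /-- the binary sequence that indexes the circle -/
  seq : BinarySeq

/-- The `ℓ₁` product metric `d((x,s),(y,t)) = d(x,y) + ∑_{i ≥ 0} 2ⁱ |sᵢ - tᵢ|`, where `d(x,y)` is
the arc-length distance of the circle `ℝ/2ℤ`, of diameter `1`. -/
noncomputable instance : MetricSpace CircleSpace where
  dist p q := dist p.pt q.pt + dist p.seq q.seq
  dist_self p := by simp
  dist_comm p q := by simp only [dist_comm]
  dist_triangle p q r := by
    have h1 := dist_triangle p.pt q.pt r.pt
    have h2 := dist_triangle p.seq q.seq r.seq
    linarith
  eq_of_dist_eq_zero {p q} h := by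
    have h1 : 0 ≤ dist p.pt q.pt := dist_nonneg
    have h2 : 0 ≤ dist p.seq q.seq := dist_nonneg
    exact CircleSpace.ext (dist_eq_zero.1 (by linarith)) (dist_eq_zero.1 (by linarith))

noncomputable instance : MeasurableSpace CircleSpace := borel _

instance : BorelSpace CircleSpace := ⟨rfl⟩

lemma CircleSpace.dist_def (p q : CircleSpace) :
    dist p q = dist p.pt q.pt + dist p.seq q.seq := rfl

/-- The line `ℝ` with half of the one-dimensional Hausdorff measure. -/
noncomputable def lineMeasure : Measure ℝ := (2 : ℝ≥0∞)⁻¹ • μH[1]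

/-- The dyadic space with the one-dimensional Hausdorff measure. -/
noncomputable def dyadicMeasure : Measure DyadicSpace := μH[1]

/-- The space `𝒯` with half of the one-dimensional Hausdorff measure. -/
noncomputable def circleMeasure : Measure CircleSpace := (2 : ℝ≥0∞)⁻¹ • μH[1]

/-!
The proof rests on comparing measures. If an open or closed ball, or a shell between two
concentric spheres, contains disjoint balls whose radii add up to its own measure, then no
nonempty open set is left over (`UniformUpTo.eq_empty_of_measure_le`).

*Connected spaces.* A sphere has at most two points, since thin shells about it are used up by
balls about any two of its points. A sphere does not consist of a single point, since such a point
would separate the space in a way that leaves too little measure on one side. It follows that the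
distance from a point `x` has no local extrema other than `x`, so that geodesics can be prolonged
in both directions (`UniformUpTo.exists_step`, `UniformUpTo.exists_beyond`). Of the two points of
a sphere about `x`, one lies on the same side of `x` as a given point and the other one on the
opposite side; this relation splits the space into two rays (`exists_sides`), and the space is the
line. The argument needs uniformity only for the radii at hand, so it applies as well to a
connected space that is uniform up to its diameter `D` and has total measure `D`. There, points
have antipodes, and the space is a circle of length `2 * D`.

*Cells.* A cell of size `ρ` is a set that lies between the open and the closed ball of radius `ρ`
about each of its points. The halves of a Besicovitch pair are cells (`IsBesicovitchPair.isCell`).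
A cell has a neighbour at distance `ρ`, together with which it forms a cell of size `2 * ρ`; every
point has a unique partner in the neighbouring cell, and distances between the two cells are
realised through partners (`IsCell.union`, `IsCell.dist_eq_add`). Folding the neighbour onto the
cell, at the scales `ρ`, `2 * ρ`, `4 * ρ`, and so on, identifies the space with the product of the
cell and the finite binary sequences (`IsCell.exists_equiv_prod`).

*Disconnected spaces.* A disconnected uniform space has a bounded open and closed set, and a point
of this set that is closest to the complement belongs to a Besicovitch pair. In the same way, a
disconnected cell consists of two cells of half its size (`IsCell.half`). Hence either there is a
connected cell, which is a circle and makes the space a copy of `𝒯`, or there are cells of all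
sizes `2 ^ k * δ`, and then the digits recorded by folding onto smaller and smaller cells identify
the space with the dyadic space `𝒮`.

*Measures.* A measure is determined by the balls of small radius if their measure is independent
of the centre (`measure_eq_of_measure_ball`). This identifies the measure on the line and on `𝒯`,
where small balls are intervals. In the dyadic case the measure is at most the Hausdorff measure
because it is uniform, and at least the Hausdorff measure on a cell, by the coverings with small
cells (`hausdorffMeasure_cell_le`).
-/

/-! ### Measures that are uniform for a range of radii -/

/-- The balls of radius `r` have measure `r`, for all positive `r` in an open lower set `J` of
radii. A 1-uniform measure has `J = Set.univ`; on a cell of size `ρ` one has `J = Set.Iio ρ`. Using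
the set of radii instead of its supremum treats both cases in real arithmetic. -/
structure UniformUpTo {Y : Type*} [MetricSpace Y] [MeasurableSpace Y] (μ : Measure Y)
    (J : Set ℝ) : Prop where
  isOpen : IsOpen J
  isLowerSet : IsLowerSet J
  zero_mem : (0 : ℝ) ∈ J
  measure_ball : ∀ (x : Y) (r : ℝ), 0 < r → r ∈ J → μ (ball x r) = ENNReal.ofReal r

lemma IsOneUniform.uniformUpTo {X : Type*} [MetricSpace X] [MeasurableSpace X] {μ : Measure X}
    (hμ : IsOneUniform μ) : UniformUpTo μ Set.univ :=
  ⟨isOpen_univ, isLowerSet_univ, Set.mem_univ _, fun x r hr _ => hμ x r hr⟩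

namespace UniformUpTo

variable {Y : Type*} [MetricSpace Y] [MeasurableSpace Y] {μ : Measure Y} {J : Set ℝ}

lemma mem_of_le (h : UniformUpTo μ J) {s t : ℝ} (ht : t ∈ J) (hst : s ≤ t) : s ∈ J :=
  h.isLowerSet hst ht

/-- There is room to enlarge a radius, by an amount below any given `ε`. -/
lemma exists_add_mem (h : UniformUpTo μ J) {t : ℝ} (ht : t ∈ J) {ε : ℝ} (hε : 0 < ε) :
    ∃ k, 0 < k ∧ k < ε ∧ t + k ∈ J := by
  obtain ⟨η, hη, hsub⟩ := Metric.isOpen_iff.1 h.isOpen t ht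
  refine ⟨min (η / 2) (ε / 2), by positivity, ?_, hsub ?_⟩
  · exact (min_le_right _ _).trans_lt (by linarith)
  · rw [mem_ball, Real.dist_eq, add_sub_cancel_left, abs_of_pos (by positivity)]
    exact (min_le_left _ _).trans_lt (by linarith)

lemma measure_closedBall (h : UniformUpTo μ J) (x : Y) {r : ℝ} (hr : 0 ≤ r) (hrJ : r ∈ J) :
    μ (closedBall x r) = ENNReal.ofReal r := by
  apply le_antisymm
  · refine ENNReal.le_of_forall_pos_le_add fun ε hε _ => ?_
    obtain ⟨k, hk, hkε, hkJ⟩ := h.exists_add_mem hrJ (ε := ε) (by exact_mod_cast hε)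
    calc μ (closedBall x r) ≤ μ (ball x (r + k)) :=
          measure_mono (closedBall_subset_ball (by linarith))
      _ = ENNReal.ofReal (r + k) := h.measure_ball x _ (by linarith) hkJ
      _ ≤ ENNReal.ofReal (r + ε) := ENNReal.ofReal_le_ofReal (by linarith)
      _ = ENNReal.ofReal r + ε := by
          rw [ENNReal.ofReal_add hr (by positivity), ENNReal.ofReal_coe_nnreal]
  · rcases hr.eq_or_lt with rfl | hr
    · simp
    · rw [← h.measure_ball x r hr hrJ]
      exact measure_mono ball_subset_closedBall

lemma measure_pos_of_isOpen (h : UniformUpTo μ J) {V : Set Y} (hV : IsOpen V) (hne : V.Nonempty) :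
    0 < μ V := by
  obtain ⟨x, hx⟩ := hne
  obtain ⟨ε, hε, hsub⟩ := Metric.isOpen_iff.1 hV x hx
  obtain ⟨k, hk, hkε, hkJ⟩ := h.exists_add_mem h.zero_mem hε
  rw [zero_add] at hkJ
  calc 0 < ENNReal.ofReal k := by simpa using hk
    _ = μ (ball x k) := (h.measure_ball x k hk hkJ).symm
    _ ≤ μ V := measure_mono ((ball_subset_ball hkε.le).trans hsub)

variable [BorelSpace Y]

/-- An open set `V` has no room next to a subset `U` of `S` that already has the measure of `S`. -/
lemma eq_empty_of_measure_le (h : UniformUpTo μ J) {U V S : Set Y} (hV : IsOpen V)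
    (hUV : Disjoint U V) (hU : U ⊆ S) (hVS : V ⊆ S) (hle : μ S ≤ μ U) (hfin : μ S ≠ ∞) :
    V = ∅ := by
  by_contra hne
  have hpos := h.measure_pos_of_isOpen hV (Set.nonempty_iff_ne_empty.2 hne)
  have h1 : μ U + μ V ≤ μ S := by
    rw [← measure_union hUV hV.measurableSet]
    exact measure_mono (Set.union_subset hU hVS)
  have hUfin : μ U ≠ ∞ := ((measure_mono hU).trans_lt hfin.lt_top).ne
  have h2 : μ U + μ V ≤ μ U + 0 := by simpa using h1.trans hle
  exact absurd ((ENNReal.add_le_add_iff_left hUfin).1 h2) (not_le.2 hpos)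

/-- The open shell `a < d(x, ·) < b` has measure `b - a`. -/
lemma measure_shell (h : UniformUpTo μ J) (x : Y) {a b : ℝ} (ha : 0 ≤ a) (hab : a < b)
    (hb : b ∈ J) : μ (ball x b \ closedBall x a) = ENNReal.ofReal (b - a) := by
  rw [measure_sdiff (closedBall_subset_ball hab) measurableSet_closedBall.nullMeasurableSet,
    h.measure_ball x b (ha.trans_lt hab) hb, h.measure_closedBall x ha (h.mem_of_le hb hab.le),
    ENNReal.ofReal_sub _ ha]
  rw [h.measure_closedBall x ha (h.mem_of_le hb hab.le)]
  exact ENNReal.ofReal_ne_top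

/-- The closed shell `a ≤ d(x, ·) ≤ b` has measure `b - a`. -/
lemma measure_closed_shell (h : UniformUpTo μ J) (x : Y) {a b : ℝ} (ha : 0 < a) (hab : a ≤ b)
    (hb : b ∈ J) : μ (closedBall x b \ ball x a) = ENNReal.ofReal (b - a) := by
  have haJ := h.mem_of_le hb hab
  rw [measure_sdiff (ball_subset_closedBall.trans (closedBall_subset_closedBall hab))
      measurableSet_ball.nullMeasurableSet,
    h.measure_ball x a ha haJ, h.measure_closedBall x (ha.le.trans hab) hb,
    ENNReal.ofReal_sub _ ha.le]
  rw [h.measure_ball x a ha haJ]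
  exact ENNReal.ofReal_ne_top

lemma exists_dist_mem_Ioo (h : UniformUpTo μ J) (x : Y) {a b : ℝ} (ha : 0 ≤ a) (hab : a < b)
    (haJ : a ∈ J) : ∃ y, a < dist x y ∧ dist x y < b := by
  obtain ⟨k, hk, hkε, hkJ⟩ := h.exists_add_mem haJ (sub_pos.2 hab)
  have h1 := h.measure_shell x ha (by linarith : a < a + k) hkJ
  have h2 : (ball x (a + k) \ closedBall x a).Nonempty := by
    apply nonempty_of_measure_ne_zero (μ := μ)
    rw [h1]
    simpa using hk
  obtain ⟨y, hy1, hy2⟩ := h2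
  rw [mem_ball'] at hy1
  rw [mem_closedBall', not_le] at hy2
  exact ⟨y, hy2, by linarith⟩

/-- A complete 1-uniform space is proper: a ball contains only boundedly many disjoint balls of a
given radius. -/
lemma properSpace (h : UniformUpTo μ Set.univ) [CompleteSpace Y] : ProperSpace Y := by
  refine ⟨fun x r =>
    isCompact_iff_totallyBounded_isComplete.2 ⟨?_, isClosed_closedBall.isComplete⟩⟩
  by_contra hnot
  rw [totallyBounded_iff_subset] at hnot
  push Not at hnot
  obtain ⟨d, hd, hd'⟩ := hnot
  obtain ⟨ε, hε, hεd⟩ := Metric.mem_uniformity_dist.1 hd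
  have hstep : ∀ t : Set Y, t.Finite → ∃ c, c ∈ closedBall x r ∧ ∀ y ∈ t, y ∈ closedBall x r →
      ε ≤ dist c y := by
    intro t ht
    have h1 := hd' (t ∩ closedBall x r) Set.inter_subset_right (ht.inter_of_left _)
    obtain ⟨c, hc, hc'⟩ := Set.not_subset.1 h1
    refine ⟨c, hc, fun y hy hy' => ?_⟩
    by_contra hlt
    exact hc' (Set.mem_biUnion (⟨hy, hy'⟩ : y ∈ t ∩ closedBall x r) (hεd (not_le.1 hlt)))
  obtain ⟨u, hu⟩ := Set.seq_of_forall_finite_exists hstep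
  have hsep : ∀ m n, m < n → ε ≤ dist (u n) (u m) := fun m n hmn =>
    (hu n).2 (u m) ⟨m, hmn, rfl⟩ (hu m).1
  have hfin := Measure.finite_const_le_meas_of_disjoint_iUnion μ
    (ε := ENNReal.ofReal (ε / 2)) (by simpa using hε)
    (As := fun n => ball (u n) (ε / 2)) (fun n => measurableSet_ball) (by
      intro m n hmn
      apply ball_disjoint_ball
      rcases lt_or_gt_of_ne hmn with hmn | hmn
      · have := hsep m n hmn
        rw [dist_comm] at this
        linarith
      · have := hsep n m hmn
        linarith) (by
      have hsub : (⋃ n, ball (u n) (ε / 2)) ⊆ closedBall x (|r| + ε) := by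
        refine Set.iUnion_subset fun n y hy => ?_
        have h1 := (hu n).1
        rw [mem_closedBall] at h1 ⊢
        rw [mem_ball] at hy
        have := dist_triangle y (u n) x
        have := le_abs_self r
        linarith
      refine ((measure_mono hsub).trans_lt ?_).ne
      rw [h.measure_closedBall x (by positivity) (Set.mem_univ _)]
      exact ENNReal.ofReal_lt_top)
  refine Set.infinite_univ (hfin.subset fun n _ => ?_)
  rw [Set.mem_ofPred_eq, h.measure_ball _ _ (by linarith) (Set.mem_univ _)]

end UniformUpTo

/-! ### Spheres of connected uniform spaces -/

/-- If a single point `y` separates the open set `Q` from the rest of a connected space, then `Q`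
has points at all distances from `y` up to the largest one. -/
lemma exists_mem_dist_eq_of_isClosed_insert {Y : Type*} [MetricSpace Y] [PreconnectedSpace Y]
    {Q : Set Y} {y z : Y} (hQ : IsOpen Q) (hy : y ∉ Q) (hcl : IsClosed (insert y Q)) (hz : z ∈ Q)
    {τ : ℝ} (hτ : 0 < τ) (hτz : τ ≤ dist y z) : ∃ q ∈ Q, dist y q = τ := by
  by_contra hnot
  push Not at hnot
  have heq : Q ∩ {q | τ < dist y q} = insert y Q ∩ {q | τ ≤ dist y q} := by
    ext q
    constructor
    · rintro ⟨h1, h2⟩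
      have h3 : τ < dist y q := h2
      exact ⟨Or.inr h1, show τ ≤ dist y q from h3.le⟩
    · rintro ⟨rfl | h1, h2⟩
      · exact absurd (h2 : τ ≤ dist q q) (by simpa using hτ)
      · exact ⟨h1, lt_of_le_of_ne h2 (Ne.symm (hnot q h1))⟩
  have hclopen : IsClopen (Q ∩ {q | τ < dist y q}) := by
    refine ⟨?_, hQ.inter (isOpen_lt continuous_const (continuous_const.dist continuous_id))⟩
    rw [heq]
    exact hcl.inter (isClosed_le continuous_const (continuous_const.dist continuous_id))
  rcases isClopen_iff.1 hclopen with h | h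
  · have : z ∈ Q ∩ {q | τ < dist y q} := ⟨hz, lt_of_le_of_ne hτz (Ne.symm (hnot z hz))⟩
    rw [h] at this
    exact this
  · have : y ∈ Q ∩ {q | τ < dist y q} := h ▸ Set.mem_univ y
    exact hy this.1

/-- If `y` and `y'` make up a sphere about `x`, the space does not lie locally outside the sphere
at `y` and inside it at `y'`: the exterior together with `y` would be open and closed. -/
lemma false_of_outside_and_inside {Y : Type*} [MetricSpace Y] [PreconnectedSpace Y] {x y y' : Y}
    {t k : ℝ} (ht : 0 < t)
    (hy : dist x y = t) (hy' : dist x y' = t) (hne : y ≠ y')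
    (hpair : ∀ z, dist x z = t → z = y ∨ z = y') (hk : 0 < k)
    (hmin : ∀ z ∈ ball y k, t ≤ dist x z) (hmax : ∀ z ∈ ball y' k, dist x z ≤ t) : False := by
  have hd := dist_pos.2 hne
  have hcont : Continuous fun z => dist x z := continuous_const.dist continuous_id
  have ho1 : IsOpen ({z | t < dist x z} ∪ {y}) := by
    have : {z | t < dist x z} ∪ {y} = {z | t < dist x z} ∪ ball y (min k (dist y y')) := by
      ext z
      constructor
      · rintro (hz | rfl)
        · exact Or.inl hz
        · exact Or.inr (mem_ball_self (by positivity))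
      · rintro (hz | hz)
        · exact Or.inl hz
        · rw [mem_ball, lt_min_iff] at hz
          rcases (hmin z hz.1).eq_or_lt with h1 | h1
          · rcases hpair z h1.symm with h2 | h2
            · exact Or.inr h2
            · rw [h2, dist_comm] at hz
              exact absurd hz.2 (lt_irrefl _)
          · exact Or.inl h1
    rw [this]
    exact (isOpen_lt continuous_const hcont).union isOpen_ball
  have ho2 : IsOpen ({z | dist x z < t} ∪ {y'}) := by
    have : {z | dist x z < t} ∪ {y'} = {z | dist x z < t} ∪ ball y' (min k (dist y y')) := by
      ext z
      constructor
      · rintro (hz | rfl)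
        · exact Or.inl hz
        · exact Or.inr (mem_ball_self (by positivity))
      · rintro (hz | hz)
        · exact Or.inl hz
        · rw [mem_ball, lt_min_iff] at hz
          rcases (hmax z hz.1).eq_or_lt with h1 | h1
          · rcases hpair z h1 with h2 | h2
            · rw [h2] at hz
              exact absurd hz.2 (lt_irrefl _)
            · exact Or.inr h2
          · exact Or.inl h1
    rw [this]
    exact (isOpen_lt hcont continuous_const).union isOpen_ball
  have hcompl : ({z | t < dist x z} ∪ {y})ᶜ = {z | dist x z < t} ∪ {y'} := by
    ext z
    have hz := hpair z
    simp only [Set.mem_compl_iff, Set.mem_union, Set.mem_ofPred_eq, Set.mem_singleton_iff]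
    constructor
    · intro h1
      push Not at h1
      rcases h1.1.eq_or_lt with h2 | h2
      · exact Or.inr ((hz h2).resolve_left h1.2)
      · exact Or.inl h2
    · rintro (h1 | rfl)
      · rintro (h2 | rfl) <;> linarith
      · rintro (h2 | h2)
        · linarith
        · exact hne h2.symm
  have hclopen : IsClopen ({z | t < dist x z} ∪ {y}) :=
    ⟨⟨by rw [hcompl]; exact ho2⟩, ho1⟩
  rcases isClopen_iff.1 hclopen with h1 | h1
  · have : y ∈ {z | t < dist x z} ∪ {y} := Or.inr rfl
    rw [h1] at this
    exact this
  · have : x ∈ {z | t < dist x z} ∪ {y} := h1 ▸ Set.mem_univ x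
    rcases this with h2 | h2
    · have : t < dist x x := h2
      simp at this
      linarith
    · rw [Set.mem_singleton_iff] at h2
      rw [h2, dist_self] at hy
      linarith

namespace UniformUpTo

variable {Y : Type*} [MetricSpace Y] [MeasurableSpace Y] [BorelSpace Y] {μ : Measure Y} {J : Set ℝ}

/-- Two points of the sphere of radius `t` already account for the measure of a thin shell about
that sphere. -/
lemma shell_subset (h : UniformUpTo μ J) {x y y' : Y} {t k : ℝ} (hy : dist x y = t)
    (hy' : dist x y' = t) (hk : 0 < k) (hkt : k ≤ t) (hkd : 2 * k ≤ dist y y') (hkJ : t + k ∈ J) :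
    ball x (t + k) \ closedBall x (t - k) ⊆ closedBall y k ∪ closedBall y' k := by
  have hkJ' : k ∈ J := h.mem_of_le hkJ (by linarith)
  have hsub : ∀ z, dist x z = t → ball z k ⊆ ball x (t + k) \ closedBall x (t - k) := by
    intro z hz w hw
    rw [mem_ball] at hw
    have h1 := dist_triangle x z w
    have h2 := dist_triangle x w z
    rw [dist_comm z w] at h1
    constructor
    · rw [mem_ball']
      linarith
    · rw [mem_closedBall', not_le]
      linarith
  have hdisj : Disjoint (ball y k) (ball y' k) := ball_disjoint_ball (by linarith)
  have hempty := h.eq_empty_of_measure_le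
    (U := ball y k ∪ ball y' k) (S := ball x (t + k) \ closedBall x (t - k))
    (V := (ball x (t + k) \ closedBall x (t - k)) \ (closedBall y k ∪ closedBall y' k))
    ((isOpen_ball.sdiff isClosed_closedBall).sdiff (isClosed_closedBall.union isClosed_closedBall))
    (Set.disjoint_of_subset_left (Set.union_subset_union ball_subset_closedBall
      ball_subset_closedBall) Set.disjoint_sdiff_right)
    (Set.union_subset (hsub y hy) (hsub y' hy')) Set.sdiff_subset
    (by
      rw [h.measure_shell x (by linarith) (by linarith) hkJ, measure_union hdisj measurableSet_ball,
        h.measure_ball y k hk hkJ', h.measure_ball y' k hk hkJ', ← ENNReal.ofReal_add hk.le hk.le]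
      exact ENNReal.ofReal_le_ofReal (by linarith))
    (by
      rw [h.measure_shell x (by linarith) (by linarith) hkJ]
      exact ENNReal.ofReal_ne_top)
  exact Set.sdiff_eq_empty.1 hempty

/-- A sphere has at most two points: thin shells about it lie in small balls about any two of its
points. -/
lemma eq_or_eq_of_dist_eq (h : UniformUpTo μ J) {x y y' z : Y} {t : ℝ} (ht : 0 < t) (htJ : t ∈ J)
    (hy : dist x y = t) (hy' : dist x y' = t) (hne : y ≠ y') (hz : dist x z = t) :
    z = y ∨ z = y' := by
  by_contra hnot
  push Not at hnot
  have h1 := dist_pos.2 hnot.1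
  have h2 := dist_pos.2 hnot.2
  have h3 := dist_pos.2 hne
  obtain ⟨k, hk, hkε, hkJ⟩ := h.exists_add_mem htJ
    (ε := min (min t (dist y y' / 2)) (min (dist z y) (dist z y'))) (by positivity)
  simp only [lt_min_iff] at hkε
  have hmem : z ∈ ball x (t + k) \ closedBall x (t - k) := by
    rw [Set.mem_sdiff, mem_ball', mem_closedBall', hz]
    exact ⟨by linarith, by linarith⟩
  rcases h.shell_subset hy hy' hk hkε.1.1.le (by linarith) hkJ hmem with hm | hm
  · rw [mem_closedBall] at hm
    linarith
  · rw [mem_closedBall] at hm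
    linarith

variable [ProperSpace Y] [PreconnectedSpace Y]

/-- If `y` separates a connected uniform space into `P` and `Q`, then `Q` reaches beyond every
admissible distance from `y`: near a point `w` of `Q` at the largest distance from `y`, a ball
about `w` would use up the measure of a shell that `P` also meets. -/
lemma exists_mem_lt_dist_of_separates (h : UniformUpTo μ J) {P Q : Set Y} {y : Y} (hP : IsOpen P)
    (hQ : IsOpen Q) (hPQ : Disjoint P Q) (hu : P ∪ Q = {y}ᶜ) (hQne : Q.Nonempty) {T : ℝ}
    (hT : T ∈ J) : ∃ q ∈ Q, T < dist y q := by
  by_contra hnot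
  push Not at hnot
  have hmem : ∀ z, z ≠ y → z ∈ P ∨ z ∈ Q := fun z hz => by
    have : z ∈ P ∪ Q := by rw [hu]; exact hz
    exact this
  have hyP : y ∉ P := fun hy => by
    have : y ∈ P ∪ Q := Or.inl hy
    rw [hu] at this
    exact this rfl
  have hyQ : y ∉ Q := fun hy => by
    have : y ∈ P ∪ Q := Or.inr hy
    rw [hu] at this
    exact this rfl
  have hcompl : ∀ {A B : Set Y}, Disjoint A B → y ∉ A → (∀ z, z ≠ y → z ∈ A ∨ z ∈ B) →
      insert y B = Aᶜ := by
    intro A B hAB hyA hAB'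
    ext z
    constructor
    · rintro (rfl | hz)
      · exact hyA
      · exact fun hzA => hAB.le_bot ⟨hzA, hz⟩
    · intro hz
      by_cases hzy : z = y
      · exact Or.inl hzy
      · exact Or.inr ((hAB' z hzy).resolve_left hz)
  have hclQ : IsClosed (insert y Q) := by
    rw [hcompl hPQ hyP hmem]
    exact hP.isClosed_compl
  have hclP : IsClosed (insert y P) := by
    rw [hcompl hPQ.symm hyQ fun z hz => (hmem z hz).symm]
    exact hQ.isClosed_compl
  have hcpt : IsCompact (insert y Q) := by
    refine (isCompact_closedBall y (max T 0)).of_isClosed_subset hclQ ?_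
    rintro z (rfl | hz)
    · simp
    · rw [mem_closedBall']
      exact (hnot z hz).trans (le_max_left _ _)
  obtain ⟨w, hw, hmax⟩ := hcpt.exists_isMaxOn ⟨y, Or.inl rfl⟩
    (continuous_const.dist continuous_id : Continuous fun z => dist y z).continuousOn
  obtain ⟨q, hq⟩ := hQne
  have hqw : dist y q ≤ dist y w := hmax (Or.inr hq)
  have hq0 : 0 < dist y q := dist_pos.2 fun hyq => hyQ (hyq ▸ hq)
  have hwQ : w ∈ Q := by
    rcases hw with rfl | hw
    · rw [dist_self] at hqw
      linarith
    · exact hw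
  set T' := dist y w with hT'
  have hT'J : T' ∈ J := h.mem_of_le hT (hnot w hwQ)
  have hT'0 : 0 < T' := hq0.trans_le hqw
  obtain ⟨z, hz, -⟩ := h.exists_dist_mem_Ioo y hT'0.le (lt_add_one T') hT'J
  have hzP : z ∈ P := by
    refine (hmem z ?_).resolve_right fun hzQ => ?_
    · rintro rfl
      simp at hz
      linarith
    · exact absurd (hmax (Or.inr hzQ) : dist y z ≤ T') (not_le.2 hz)
  obtain ⟨ε, hε, hball⟩ := Metric.isOpen_iff.1 hQ w hwQ
  set k := min ε T' / 2 with hk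
  have hk0 : 0 < k := by positivity
  have hkε : k < ε := by
    have := min_le_left ε T'
    linarith
  have hkT : k < T' := by
    have := min_le_right ε T'
    linarith
  have hkball : ball w k ⊆ Q := (ball_subset_ball hkε.le).trans hball
  obtain ⟨p, hpP, hp⟩ := exists_mem_dist_eq_of_isClosed_insert hP hyP hclP hzP
    (τ := T' - k / 2) (by linarith) (by linarith)
  have hempty := h.eq_empty_of_measure_le (U := ball w k)
    (V := P ∩ (ball y T' \ closedBall y (T' - k)))
    (S := closedBall y T' \ ball y (T' - k))
    (hP.inter (isOpen_ball.sdiff isClosed_closedBall))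
    (Set.disjoint_of_subset hkball Set.inter_subset_left hPQ.symm)
    (by
      intro v hv
      refine ⟨?_, ?_⟩
      · rw [mem_closedBall']
        exact hmax (Or.inr (hkball hv))
      · rw [mem_ball', not_lt]
        rw [mem_ball] at hv
        have := dist_triangle y v w
        linarith)
    (by
      rintro v ⟨-, hv1, hv2⟩
      exact ⟨ball_subset_closedBall hv1, fun hv => hv2 (ball_subset_closedBall hv)⟩)
    (by
      rw [h.measure_closed_shell y (by linarith) (by linarith) hT'J,
        h.measure_ball w k hk0 (h.mem_of_le hT'J hkT.le)]
      exact ENNReal.ofReal_le_ofReal (by linarith))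
    (by
      rw [h.measure_closed_shell y (by linarith) (by linarith) hT'J]
      exact ENNReal.ofReal_ne_top)
  have : p ∈ P ∩ (ball y T' \ closedBall y (T' - k)) := by
    refine ⟨hpP, ?_, ?_⟩
    · rw [mem_ball']
      linarith
    · rw [mem_closedBall', not_le]
      linarith
  rw [hempty] at this
  exact this

/-- No sphere of a connected uniform space is a single point `y`: otherwise `y` would separate the
ball about `x` from its exterior, and then `x` would separate the part of the ball that is far from
`y` from the rest; that part is too short. -/
lemma exists_ne_dist_eq (h : UniformUpTo μ J) {x y : Y} {t : ℝ} (ht : 0 < t) (htJ : t ∈ J)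
    (hy : dist x y = t) : ∃ y', y' ≠ y ∧ dist x y' = t := by
  by_contra hnot
  have huniq : ∀ z, dist x z = t → z = y := fun z hz => by
    by_contra hzy
    exact hnot ⟨z, hzy, hz⟩
  set P := ball x t with hP
  set Q := (closedBall x t)ᶜ with hQ
  have hPo : IsOpen P := isOpen_ball
  have hQo : IsOpen Q := isClosed_closedBall.isOpen_compl
  have hPQ : Disjoint P Q :=
    Set.disjoint_of_subset_left ball_subset_closedBall disjoint_compl_right
  have hyx : dist y x = t := by rw [dist_comm, hy]
  have hu : P ∪ Q = {y}ᶜ := by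
    ext z
    simp only [hP, hQ, Set.mem_union, mem_ball', Set.mem_compl_iff, mem_closedBall', not_le,
      Set.mem_singleton_iff]
    constructor
    · rintro hz rfl
      rcases hz with hz | hz <;> linarith
    · intro hz
      rcases lt_trichotomy (dist x z) t with h1 | h1 | h1
      · exact Or.inl h1
      · exact absurd (huniq z h1) hz
      · exact Or.inr h1
  have hxP : x ∈ P := mem_ball_self ht
  obtain ⟨z, hz, -⟩ := h.exists_dist_mem_Ioo x ht.le (lt_add_one t) htJ
  have hzQ : z ∈ Q := by
    rw [hQ, Set.mem_compl_iff, mem_closedBall', not_le]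
    exact hz
  obtain ⟨q, hqQ, hq⟩ := h.exists_mem_lt_dist_of_separates hPo hQo hPQ hu ⟨z, hzQ⟩ htJ
  obtain ⟨p, hpP, hp⟩ := h.exists_mem_lt_dist_of_separates hQo hPo hPQ.symm
    (by rw [Set.union_comm, hu]) ⟨x, hxP⟩ htJ
  have hyQ : y ∉ Q := by simp [hQ, hyx]
  have hinsP : insert y P = Qᶜ := by
    rw [hQ, compl_compl]
    ext v
    constructor
    · rintro (rfl | hv)
      · simp [hyx]
      · exact ball_subset_closedBall hv
    · intro hv
      rw [mem_closedBall'] at hv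
      rcases hv.eq_or_lt with hv | hv
      · exact Or.inl (huniq v hv)
      · exact Or.inr (mem_ball'.2 hv)
  have hinsQ : insert y Q = Pᶜ := by
    ext v
    simp only [hQ, hP, Set.mem_insert_iff, Set.mem_compl_iff, mem_closedBall', mem_ball', not_le,
      not_lt]
    constructor
    · rintro (rfl | hv)
      · exact hy.ge
      · exact hv.le
    · intro hv
      rcases hv.eq_or_lt with hv | hv
      · exact Or.inl (huniq v hv.symm)
      · exact Or.inr hv
  obtain ⟨q', hq'Q, hq'⟩ := exists_mem_dist_eq_of_isClosed_insert hQo hyQ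
    (by rw [hinsQ]; exact hPo.isClosed_compl) hqQ ht hq.le
  have hxq' : x ≠ q' := fun hx => hPQ.le_bot ⟨hxP, hx ▸ hq'Q⟩
  set P2 := P ∩ {v | t < dist y v} with hP2
  have hP2o : IsOpen P2 :=
    hPo.inter (isOpen_lt continuous_const (continuous_const.dist continuous_id))
  have hins2 : insert x P2 = insert y P ∩ {v | t ≤ dist y v} := by
    ext v
    constructor
    · rintro (rfl | ⟨h1, h2⟩)
      · exact ⟨Or.inr hxP, hyx.ge⟩
      · have h3 : t < dist y v := h2
        exact ⟨Or.inr h1, show t ≤ dist y v from h3.le⟩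
    · rintro ⟨rfl | h1, h2⟩
      · exact absurd (h2 : t ≤ dist v v) (by simpa using ht)
      · rcases (show t ≤ dist y v from h2).eq_or_lt with h3 | h3
        · rcases h.eq_or_eq_of_dist_eq ht htJ hyx hq' hxq' h3.symm with h4 | h4
          · exact Or.inl h4
          · exact (hPQ.le_bot (⟨h1, h4 ▸ hq'Q⟩ : v ∈ P ∩ Q)).elim
        · exact Or.inr ⟨h1, h3⟩
  have hins2cl : IsClosed (insert x P2) := by
    rw [hins2, hinsP]
    exact hQo.isClosed_compl.inter
      (isClosed_le continuous_const (continuous_const.dist continuous_id))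
  have hx2 : x ∉ P2 := fun hx => by
    have : t < dist y x := hx.2
    linarith
  obtain ⟨v, hv, hv'⟩ := h.exists_mem_lt_dist_of_separates (P := (insert x P2)ᶜ) (Q := P2) (y := x)
    hins2cl.isOpen_compl hP2o
    (Set.disjoint_of_subset_right (Set.subset_insert x P2) disjoint_compl_left)
    (by
      ext v
      simp only [Set.mem_union, Set.mem_compl_iff, Set.mem_insert_iff, Set.mem_singleton_iff]
      constructor
      · rintro (h1 | h1) rfl
        · exact h1 (Or.inl rfl)
        · exact hx2 h1
      · tauto)
    ⟨p, hpP, hp⟩ htJ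
  have : dist x v < t := mem_ball'.1 hv.1
  linarith

/-- The distance from `x` has no local minimum at `y ≠ x`. Otherwise a ball about `y` would use up
the measure of a shell outside the sphere of `y`, so that near the other point `y'` of this sphere
the space would lie inside the sphere, and the exterior with `y` would be open and closed. -/
lemma exists_mem_ball_dist_lt (h : UniformUpTo μ J) {x y : Y} {t k : ℝ} (ht : 0 < t) (htJ : t ∈ J)
    (hy : dist x y = t) (hk : 0 < k) : ∃ z ∈ ball y k, dist x z < t := by
  by_contra hnot
  push Not at hnot
  obtain ⟨y', hne, hy'⟩ := h.exists_ne_dist_eq ht htJ hy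
  have hd := dist_pos.2 hne.symm
  obtain ⟨k', hk', hkε, hkJ⟩ := h.exists_add_mem htJ (ε := min k (dist y y' / 2)) (by positivity)
  rw [lt_min_iff] at hkε
  have hempty := h.eq_empty_of_measure_le (U := ball y k') (V := ball y' k' ∩ (closedBall x t)ᶜ)
    (S := closedBall x (t + k') \ ball x t)
    (isOpen_ball.inter isClosed_closedBall.isOpen_compl)
    (Set.disjoint_of_subset_right Set.inter_subset_left (ball_disjoint_ball (by linarith)))
    (by
      intro z hz
      refine ⟨?_, ?_⟩
      · rw [mem_ball'] at hz
        rw [mem_closedBall']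
        have := dist_triangle x y z
        linarith
      · rw [mem_ball', not_lt]
        exact hnot z (ball_subset_ball hkε.1.le hz))
    (by
      rintro z ⟨hz, hz'⟩
      rw [Set.mem_compl_iff, mem_closedBall', not_le] at hz'
      refine ⟨?_, ?_⟩
      · rw [mem_ball'] at hz
        rw [mem_closedBall']
        have := dist_triangle x y' z
        linarith
      · rw [mem_ball', not_lt]
        exact hz'.le)
    (by
      rw [h.measure_closed_shell x ht (by linarith) hkJ,
        h.measure_ball y k' hk' (h.mem_of_le hkJ (by linarith))]
      exact ENNReal.ofReal_le_ofReal (by linarith))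
    (by
      rw [h.measure_closed_shell x ht (by linarith) hkJ]
      exact ENNReal.ofReal_ne_top)
  refine false_of_outside_and_inside ht hy hy' hne.symm
    (fun z hz => h.eq_or_eq_of_dist_eq ht htJ hy hy' hne.symm hz) hk'
    (fun z hz => hnot z (ball_subset_ball hkε.1.le hz)) (fun z hz => ?_)
  by_contra hlt
  have : z ∈ ball y' k' ∩ (closedBall x t)ᶜ := ⟨hz, by
    rwa [Set.mem_compl_iff, mem_closedBall']⟩
  rw [hempty] at this
  exact this

/-- The distance from `x` has no local maximum at `y`. The reason is the one for local minima,
with the interior and the exterior of the sphere of `y` interchanged. -/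
lemma exists_mem_ball_lt_dist (h : UniformUpTo μ J) {x y : Y} {t k : ℝ} (ht : 0 < t) (htJ : t ∈ J)
    (hy : dist x y = t) (hk : 0 < k) : ∃ z ∈ ball y k, t < dist x z := by
  by_contra hnot
  push Not at hnot
  obtain ⟨y', hne, hy'⟩ := h.exists_ne_dist_eq ht htJ hy
  have hd := dist_pos.2 hne.symm
  set k' := min (min k t) (dist y y' / 2) / 2 with hk'def
  have hk' : 0 < k' := by positivity
  have hkε : k' < k ∧ k' < t ∧ k' < dist y y' / 2 := by
    have h1 := min_le_left (min k t) (dist y y' / 2)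
    have h2 := min_le_right (min k t) (dist y y' / 2)
    have h3 := min_le_left k t
    have h4 := min_le_right k t
    refine ⟨?_, ?_, ?_⟩ <;> linarith
  have hempty := h.eq_empty_of_measure_le (U := ball y k') (V := ball y' k' ∩ ball x t)
    (S := closedBall x t \ ball x (t - k'))
    (isOpen_ball.inter isOpen_ball)
    (Set.disjoint_of_subset_right Set.inter_subset_left (ball_disjoint_ball (by linarith)))
    (by
      intro z hz
      refine ⟨?_, ?_⟩
      · rw [mem_closedBall']
        exact hnot z (ball_subset_ball hkε.1.le hz)
      · rw [mem_ball', not_lt]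
        rw [mem_ball] at hz
        have := dist_triangle x z y
        linarith)
    (by
      rintro z ⟨hz, hz'⟩
      refine ⟨ball_subset_closedBall hz', ?_⟩
      rw [mem_ball', not_lt]
      rw [mem_ball] at hz
      have := dist_triangle x z y'
      linarith)
    (by
      rw [h.measure_closed_shell x (by linarith) (by linarith) htJ,
        h.measure_ball y k' hk' (h.mem_of_le htJ (by linarith))]
      exact ENNReal.ofReal_le_ofReal (by linarith))
    (by
      rw [h.measure_closed_shell x (by linarith) (by linarith) htJ]
      exact ENNReal.ofReal_ne_top)
  refine false_of_outside_and_inside ht hy' hy hne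
    (fun z hz => h.eq_or_eq_of_dist_eq ht htJ hy' hy hne hz) hk'
    (fun z hz => ?_) (fun z hz => hnot z (ball_subset_ball hkε.1.le hz))
  by_contra hlt
  have : z ∈ ball y' k' ∩ ball x t := ⟨hz, by
    rw [mem_ball']
    exact not_le.1 hlt⟩
  rw [hempty] at this
  exact this

end UniformUpTo

/-! ### Geodesics in connected uniform spaces -/

/-- Continuous induction along a geodesic: if the distance from `x` can be changed at unit speed
`σ = ±1` from every point reached so far, then it can be changed at unit speed from `y` all the way
up to length `L`. -/
lemma exists_dist_eq_add_of_step {Y : Type*} [MetricSpace Y] [ProperSpace Y] {x y : Y}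
    {s L σ : ℝ} (hσ : |σ| = 1) (hy : dist x y = s)
    (hstep : ∀ (z : Y) (u : ℝ), 0 ≤ u → u < L → dist x z = s + σ * u → dist y z = u →
      ∃ η, 0 < η ∧ ∀ k, 0 < k → k < η → ∃ z', dist x z' = s + σ * (u + k) ∧ dist z z' = k) :
    ∀ u, 0 ≤ u → u ≤ L → ∃ z, dist x z = s + σ * u ∧ dist y z = u := by
  set S : Set ℝ := {u | ∃ z, dist x z = s + σ * u ∧ dist y z = u} with hS
  have hcl : IsClosed (S ∩ Set.Icc 0 L) := by
    have heq : S ∩ Set.Icc 0 L =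
        (fun z => dist y z) '' ({z | dist x z = s + σ * dist y z} ∩ closedBall y L) := by
      ext u
      constructor
      · rintro ⟨⟨z, hz, hz'⟩, hu⟩
        refine ⟨z, ⟨?_, ?_⟩, hz'⟩
        · change dist x z = s + σ * dist y z
          rw [hz, hz']
        · rw [mem_closedBall', hz']
          exact hu.2
      · rintro ⟨z, ⟨hz, hz'⟩, rfl⟩
        exact ⟨⟨z, hz, rfl⟩, dist_nonneg, mem_closedBall'.1 hz'⟩
    rw [heq]
    have hy' : Continuous fun z => dist y z := continuous_const.dist continuous_id
    refine (((isCompact_closedBall y L).inter_left ?_).image hy').isClosed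
    exact isClosed_eq (continuous_const.dist continuous_id)
      (continuous_const.add (continuous_const.mul hy'))
  have hsub := hcl.Icc_subset_of_forall_exists_gt (a := 0) (b := L) ⟨y, by simp [hy]⟩ (by
    rintro u ⟨⟨z, hz, hz'⟩, hu0, huL⟩ v hv
    obtain ⟨η, hη, hη'⟩ := hstep z u hu0 huL hz hz'
    have huv : 0 < v - u := sub_pos.2 hv
    set k := min η (v - u) / 2 with hk
    have hk0 : 0 < k := by positivity
    have hk1 : k < η := by
      have := min_le_left η (v - u)
      linarith
    have hk2 : k < v - u := by
      have := min_le_right η (v - u)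
      linarith
    obtain ⟨z', h1, h2⟩ := hη' k hk0 hk1
    refine ⟨u + k, ⟨z', h1, le_antisymm ?_ ?_⟩, by linarith, by linarith⟩
    · have := dist_triangle y z z'
      linarith
    · have h3 := abs_dist_sub_le z' y x
      rw [dist_comm z' x, dist_comm y x, h1, hy, add_sub_cancel_left, abs_mul, hσ, one_mul,
        dist_comm z' y] at h3
      exact (le_abs_self _).trans h3)
  exact fun u h0 hL => hsub ⟨h0, hL⟩

namespace UniformUpTo

variable {Y : Type*} [MetricSpace Y] [MeasurableSpace Y] [BorelSpace Y] {μ : Measure Y} {J : Set ℝ}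
variable [ProperSpace Y] [PreconnectedSpace Y]

/-- Near a point `y` the distance from `x` can be decreased and increased at unit speed. -/
lemma exists_step (h : UniformUpTo μ J) {x y : Y} {t : ℝ} (ht : 0 < t) (htJ : t ∈ J)
    (hy : dist x y = t) : ∃ η, 0 < η ∧ ∀ k, 0 < k → k < η →
      (∃ z, dist x z = t - k ∧ dist y z = k) ∧ (∃ z, dist x z = t + k ∧ dist y z = k) := by
  obtain ⟨y', hne, hy'⟩ := h.exists_ne_dist_eq ht htJ hy
  have hd := dist_pos.2 hne.symm
  obtain ⟨η, hη, hηε, hηJ⟩ := h.exists_add_mem htJ (ε := min t (dist y y' / 4)) (by positivity)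
  rw [lt_min_iff] at hηε
  have hnear : ∀ z k, dist y z ≤ η → 0 < k → k ≤ η → t - k < dist x z → dist x z < t + k →
      dist y z ≤ k := by
    intro z k hz hk hkη h1 h2
    have hmem : z ∈ ball x (t + k) \ closedBall x (t - k) := by
      rw [Set.mem_sdiff, mem_ball', mem_closedBall', not_le]
      exact ⟨h2, h1⟩
    rcases h.shell_subset hy hy' hk (by linarith) (by linarith)
      (h.mem_of_le hηJ (by linarith)) hmem with h3 | h3
    · exact mem_closedBall'.1 h3
    · rw [mem_closedBall] at h3
      have := dist_triangle y z y'
      linarith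
  have hexact : ∀ z k, 0 < k → k < η → dist y z ≤ η → |dist x z - t| = k → dist y z = k := by
    intro z k hk hkη hz hzk
    apply le_antisymm
    · refine le_of_forall_gt_imp_ge_of_dense fun k' hk' => ?_
      have h1 := abs_le.1 hzk.le
      rcases le_total k' η with h2 | h2
      · exact hnear z k' hz (by linarith) h2 (by linarith) (by linarith)
      · linarith
    · have := abs_dist_sub_le z y x
      rw [dist_comm z x, dist_comm y x, hy, hzk, dist_comm z y] at this
      exact this
  have hcont : Continuous fun z => dist x z := continuous_const.dist continuous_id
  refine ⟨η, hη, fun k hk hkη => ⟨?_, ?_⟩⟩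
  · suffices ∃ z, dist x z = t - k ∧ dist y z ≤ η by
      obtain ⟨z, hz, hz'⟩ := this
      exact ⟨z, hz, hexact z k hk hkη hz' (by rw [hz]; simp [abs_of_pos hk])⟩
    by_contra hnot
    push Not at hnot
    have hK : IsCompact (closedBall y η ∩ {z | t - k ≤ dist x z}) :=
      (isCompact_closedBall y η).inter_right (isClosed_le continuous_const hcont)
    have hyK : y ∈ closedBall y η ∩ {z | t - k ≤ dist x z} := by
      refine ⟨mem_closedBall_self hη.le, ?_⟩
      change t - k ≤ dist x y
      linarith
    -- A point `w` at the smallest distance from `x` would be a local minimum of that distance.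
    obtain ⟨w, ⟨hw1, hw2⟩, hmin⟩ := hK.exists_isMinOn ⟨y, hyK⟩ hcont.continuousOn
    have hwt : dist x w ≤ t := by
      have : dist x w ≤ dist x y := hmin hyK
      linarith
    rw [mem_closedBall'] at hw1
    have hwk : t - k < dist x w :=
      lt_of_le_of_ne hw2 fun heq => absurd hw1 (not_le.2 (hnot w heq.symm))
    have hwk' := hnear w k hw1 hk hkη.le hwk (by linarith)
    obtain ⟨z, hz, hz'⟩ := h.exists_mem_ball_dist_lt (x := x) (y := w) (t := dist x w)
      (k := min (η - k) (dist x w - (t - k))) (by linarith) (h.mem_of_le htJ hwt) rfl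
      (lt_min (by linarith) (by linarith))
    rw [mem_ball', lt_min_iff] at hz
    have hzK : z ∈ closedBall y η ∩ {z | t - k ≤ dist x z} := by
      refine ⟨?_, ?_⟩
      · rw [mem_closedBall']
        have := dist_triangle y w z
        linarith
      · change t - k ≤ dist x z
        have := dist_triangle x z w
        rw [dist_comm z w] at this
        linarith
    have : dist x w ≤ dist x z := hmin hzK
    linarith
  · suffices ∃ z, dist x z = t + k ∧ dist y z ≤ η by
      obtain ⟨z, hz, hz'⟩ := this
      exact ⟨z, hz, hexact z k hk hkη hz' (by rw [hz]; simp [abs_of_pos hk])⟩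
    by_contra hnot
    push Not at hnot
    have hK : IsCompact (closedBall y η ∩ {z | dist x z ≤ t + k}) :=
      (isCompact_closedBall y η).inter_right (isClosed_le hcont continuous_const)
    have hyK : y ∈ closedBall y η ∩ {z | dist x z ≤ t + k} := by
      refine ⟨mem_closedBall_self hη.le, ?_⟩
      change dist x y ≤ t + k
      linarith
    -- A point `w` at the largest distance from `x` would be a local maximum of that distance.
    obtain ⟨w, ⟨hw1, hw2⟩, hmax⟩ := hK.exists_isMaxOn ⟨y, hyK⟩ hcont.continuousOn
    have hwt : t ≤ dist x w := by
      have : dist x y ≤ dist x w := hmax hyK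
      linarith
    rw [mem_closedBall'] at hw1
    have hwk : dist x w < t + k :=
      lt_of_le_of_ne hw2 fun heq => absurd hw1 (not_le.2 (hnot w heq))
    have hwk' := hnear w k hw1 hk hkη.le (by linarith) hwk
    obtain ⟨z, hz, hz'⟩ := h.exists_mem_ball_lt_dist (x := x) (y := w) (t := dist x w)
      (k := min (η - k) (t + k - dist x w)) (by linarith) (h.mem_of_le hηJ (by linarith)) rfl
      (lt_min (by linarith) (by linarith))
    rw [mem_ball', lt_min_iff] at hz
    have hzK : z ∈ closedBall y η ∩ {z | dist x z ≤ t + k} := by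
      refine ⟨?_, ?_⟩
      · rw [mem_closedBall']
        have := dist_triangle y w z
        linarith
      · change dist x z ≤ t + k
        have := dist_triangle x w z
        linarith
    have : dist x z ≤ dist x w := hmax hzK
    linarith

/-- Geodesics towards `x`. -/
lemma exists_between (h : UniformUpTo μ J) {x y : Y} {s t : ℝ} (hy : dist x y = s) (hs : s ∈ J)
    (ht : 0 ≤ t) (hts : t ≤ s) : ∃ z, dist x z = t ∧ dist y z = s - t := by
  obtain ⟨z, hz, hz'⟩ := exists_dist_eq_add_of_step (x := x) (y := y) (s := s) (L := s) (σ := -1)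
    (by simp) hy (by
      intro z u hu0 hus hz _
      obtain ⟨η, hη, hη'⟩ := h.exists_step (x := x) (y := z) (t := s - u) (by linarith)
        (h.mem_of_le hs (by linarith)) (by linarith)
      refine ⟨η, hη, fun k hk hkη => ?_⟩
      obtain ⟨z', h1, h2⟩ := (hη' k hk hkη).1
      exact ⟨z', by linarith, h2⟩) (s - t) (by linarith) (by linarith)
  exact ⟨z, by linarith, hz'⟩

/-- Geodesics away from `x` can be prolonged through `y`. -/
lemma exists_beyond (h : UniformUpTo μ J) {x y : Y} {s L : ℝ} (hs : 0 < s) (hy : dist x y = s)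
    (hL0 : 0 ≤ L) (hL : ∀ u, u < L → s + u ∈ J) : ∃ z, dist x z = s + L ∧ dist y z = L := by
  obtain ⟨z, hz, hz'⟩ := exists_dist_eq_add_of_step (x := x) (y := y) (s := s) (L := L) (σ := 1)
    (by simp) hy (by
      intro z u hu0 hus hz _
      obtain ⟨η, hη, hη'⟩ := h.exists_step (x := x) (y := z) (t := s + u) (by linarith)
        (hL u hus) (by linarith)
      refine ⟨η, hη, fun k hk hkη => ?_⟩
      obtain ⟨z', h1, h2⟩ := (hη' k hk hkη).2
      exact ⟨z', by linarith, h2⟩) L hL0 le_rfl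
  exact ⟨z, by linarith, hz'⟩

/-- The two points of a sphere about `x`, seen from a point `p`: one lies on the same side of `x`
as `p`, the other one on the opposite side. -/
lemma exists_same_opposite (h : UniformUpTo μ J) {x p : Y} {a : ℝ} (ha : 0 < a) (haJ : a ∈ J)
    (hp : 0 < dist x p) (hpJ : dist x p ∈ J) (hJ : ∀ u, u < a → dist x p + u ∈ J) :
    ∃ q q', dist x q = a ∧ dist x q' = a ∧ dist p q = |a - dist x p| ∧
      dist p q' = a + dist x p ∧ ∀ z, dist x z = a → z = q ∨ z = q' := by
  obtain ⟨q', h1, h2⟩ := h.exists_beyond (x := p) (y := x) hp (dist_comm p x) ha.le hJ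
  obtain ⟨q, h3, h4⟩ : ∃ q, dist x q = a ∧ dist p q = |a - dist x p| := by
    rcases le_total a (dist x p) with hle | hle
    · obtain ⟨q, h3, h4⟩ := h.exists_between (x := x) (y := p) rfl hpJ ha.le hle
      exact ⟨q, h3, by rw [h4, abs_sub_comm, abs_of_nonneg (by linarith)]⟩
    · obtain ⟨q, h3, h4⟩ := h.exists_beyond (x := x) (y := p) (L := a - dist x p) hp rfl
        (by linarith) fun u hu => h.mem_of_le haJ (by linarith)
      exact ⟨q, by linarith, by rw [h4, abs_of_nonneg (by linarith)]⟩
  have hne : q ≠ q' := by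
    rintro rfl
    have : |a - dist x p| < a + dist x p := abs_lt.2 ⟨by linarith, by linarith⟩
    linarith
  exact ⟨q, q', h3, h2, h4, by linarith, fun z hz => h.eq_or_eq_of_dist_eq ha haJ h3 h2 hne hz⟩

end UniformUpTo

/-- The two sides of a base point. Suppose that from every point `p`, exactly one of the two points
of each sphere about `x` is as close as the triangle inequality permits, the other one being at
distance `M`. Then the space without `x` splits into two sides, on each of which the distance is
the difference of the distances from `x`. -/
lemma exists_sides {Y : Type*} [MetricSpace Y] {x : Y} {Λ : Set ℝ} {M : ℝ → ℝ → ℝ}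
    (hΛ : Λ.Nonempty) (hM : ∀ s ∈ Λ, ∀ t ∈ Λ, |s - t| < M s t)
    (hne : ∀ a ∈ Λ, ∃ p, dist x p = a)
    (hmate : ∀ p, dist x p ∈ Λ → ∀ a ∈ Λ, ∃ q q', dist x q = a ∧ dist x q' = a ∧
      dist p q = |a - dist x p| ∧ dist p q' = M a (dist x p) ∧
      ∀ z, dist x z = a → z = q ∨ z = q') :
    ∃ A : Set Y, (∀ p q, dist x p ∈ Λ → dist x q ∈ Λ → (p ∈ A ↔ q ∈ A) →
        dist p q = |dist x p - dist x q|) ∧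
      (∀ p q, dist x p ∈ Λ → dist x q ∈ Λ → ¬ (p ∈ A ↔ q ∈ A) →
        dist p q = M (dist x p) (dist x q)) ∧
      (∀ a ∈ Λ, (∃ p ∈ A, dist x p = a) ∧ ∃ p ∉ A, dist x p = a) := by
  set R : Y → Y → Prop := fun p q => dist p q = |dist x p - dist x q| with hR
  have hsymm : ∀ {p q}, R p q → R q p := fun {p q} hpq => by
    simp only [hR] at hpq ⊢
    rw [dist_comm, hpq, abs_sub_comm]
  have hexists : ∀ p, dist x p ∈ Λ → ∀ a ∈ Λ, ∃ q, dist x q = a ∧ R p q := by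
    intro p hp a ha
    obtain ⟨q, q', h1, h2, h3, h4, h5⟩ := hmate p hp a ha
    exact ⟨q, h1, by simp only [hR]; rw [h3, h1, abs_sub_comm]⟩
  have hdich : ∀ p q, dist x p ∈ Λ → dist x q ∈ Λ → ¬ R p q →
      dist p q = M (dist x q) (dist x p) := by
    intro p q hp hq hpq
    obtain ⟨r, r', h1, h2, h3, h4, h5⟩ := hmate p hp _ hq
    rcases h5 q rfl with rfl | rfl
    · exact absurd (by simp only [hR]; rw [h3, abs_sub_comm]) hpq
    · exact h4
  have huniq : ∀ p q r, dist x p ∈ Λ → dist x q ∈ Λ → dist x q = dist x r → R p q → R p r →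
      q = r := by
    intro p q r hp hq hqr hpq hpr
    obtain ⟨w, w', h1, h2, h3, h4, h5⟩ := hmate p hp _ hq
    have h6 := hM _ hq _ hp
    have key : ∀ z, dist x z = dist x q → R p z → z = w := by
      intro z hz hpz
      rcases h5 z hz with rfl | rfl
      · rfl
      · simp only [hR] at hpz
        rw [h4, hz, abs_sub_comm] at hpz
        linarith
    rw [key q rfl hpq, key r hqr.symm hpr]
  -- Transitivity when the middle point is also in the middle for the distance from `x`.
  have hmid : ∀ p q r, dist x p ∈ Λ → dist x r ∈ Λ → R p q → R q r →
      dist x p ≤ dist x q → dist x q ≤ dist x r → R p r := by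
    intro p q r hp hr hpq hqr h1 h2
    by_contra hpr
    have h3 := hdich p r hp hr hpr
    have h4 := hM _ hr _ hp
    have h5 := dist_triangle p q r
    simp only [hR] at hpq hqr
    rw [abs_of_nonpos (by linarith)] at hpq hqr
    rw [abs_of_nonneg (by linarith)] at h4
    linarith
  have hmid' : ∀ p q r, dist x p ∈ Λ → dist x r ∈ Λ → R p q → R q r →
      dist x r ≤ dist x q → dist x q ≤ dist x p → R p r := fun p q r hp hr hpq hqr h1 h2 =>
    hsymm (hmid r q p hr hp (hsymm hqr) (hsymm hpq) h1 h2)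
  have htrans_mono : ∀ p q r, dist x p ∈ Λ → dist x q ∈ Λ → dist x r ∈ Λ → R p q → R q r →
      dist x p ≤ dist x r → R p r := by
    intro p q r hp hq hr hpq hqr hle
    rcases le_total (dist x q) (dist x p) with h1 | h1
    · -- `q` is closest to `x`: compare with the point `w` related to `r` at the distance of `p`.
      obtain ⟨w, hw, hrw⟩ := hexists r hr _ hp
      have hqw : R q w := by
        obtain ⟨v, hv, hwv⟩ := hexists w (hw ▸ hp) _ hq
        have hvr : R v r := hmid v w r (hv ▸ hq) hr (hsymm hwv) (hsymm hrw)
          (by linarith) (by linarith)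
        have : q = v := huniq r q v hr hq hv.symm (hsymm hqr) (hsymm hvr)
        rw [this]
        exact hsymm hwv
      have : p = w := huniq q p w hq hp hw.symm (hsymm hpq) hqw
      rw [this]
      exact hsymm hrw
    · rcases le_total (dist x q) (dist x r) with h2 | h2
      · exact hmid p q r hp hr hpq hqr h1 h2
      · -- `q` is farthest from `x`.
        obtain ⟨w, hw, hrw⟩ := hexists r hr _ hp
        have hwq : R w q := hmid w r q (hw ▸ hp) hq (hsymm hrw) (hsymm hqr) (by linarith) h2
        have : p = w := huniq q p w hq hp hw.symm (hsymm hpq) (hsymm hwq)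
        rw [this]
        exact hsymm hrw
  have htrans : ∀ p q r, dist x p ∈ Λ → dist x q ∈ Λ → dist x r ∈ Λ → R p q → R q r → R p r := by
    intro p q r hp hq hr hpq hqr
    rcases le_total (dist x p) (dist x r) with h1 | h1
    · exact htrans_mono p q r hp hq hr hpq hqr h1
    · exact hsymm (htrans_mono r q p hr hq hp (hsymm hqr) (hsymm hpq) h1)
  obtain ⟨b, hb⟩ := hΛ
  obtain ⟨o, ho⟩ := hne b hb
  have hoΛ : dist x o ∈ Λ := ho ▸ hb
  have hA : ∀ p, dist x p ∈ Λ → ¬ R o p → ∀ q, dist x q = dist x p → R o q → ∀ r,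
      dist x r ∈ Λ → (R p r ↔ ¬ R o r) := by
    intro p hp hop q hq hoq r hr
    obtain ⟨w, w', h1, h2, h3, h4, h5⟩ := hmate r hr _ hp
    have hrw : R r w := by simp only [hR]; rw [h3, h1, abs_sub_comm]
    have hpq : p ≠ q := fun heq => hop (heq ▸ hoq)
    constructor
    · exact fun hpr hor => hop (htrans o r p hoΛ hr hp hor (hsymm hpr))
    · intro hor
      rcases h5 p rfl with h6 | h6
      · rw [h6]
        exact hsymm hrw
      · rcases h5 q hq with h7 | h7
        · rw [h7] at hoq
          exact absurd (htrans o w r hoΛ (h1 ▸ hp) hr hoq (hsymm hrw)) hor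
        · exact absurd (h6.trans h7.symm) hpq
  refine ⟨{p | R o p}, ?_, ?_, ?_⟩
  · intro p q hp hq hiff
    change R p q
    have hiff' : R o p ↔ R o q := hiff
    by_cases hop : R o p
    · exact htrans p o q hp hoΛ hq (hsymm hop) (hiff'.1 hop)
    · obtain ⟨w, hw, how⟩ := hexists o hoΛ _ hp
      exact (hA p hp hop w hw how q hq).2 fun hoq => hop (hiff'.2 hoq)
  · intro p q hp hq hiff
    have hiff' : ¬ (R o p ↔ R o q) := hiff
    rw [dist_comm]
    refine hdich q p hq hp fun hqp => hiff' ⟨fun hop => ?_, fun hoq => ?_⟩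
    · exact htrans o p q hoΛ hp hq hop (hsymm hqp)
    · exact htrans o q p hoΛ hq hp hoq hqp
  · intro a ha
    obtain ⟨w, w', h1, h2, h3, h4, h5⟩ := hmate o hoΛ a ha
    refine ⟨⟨w, ?_, h1⟩, ⟨w', ?_, h2⟩⟩
    · change R o w
      simp only [hR]
      rw [h3, h1, abs_sub_comm]
    · change ¬ R o w'
      simp only [hR]
      rw [h4, h2]
      have := hM a ha _ hoΛ
      rw [abs_sub_comm] at this
      exact this.ne'

/-! ### The line and the circle -/

lemma AddCircle.norm_coe_of_abs_le_one {u : ℝ} (hu : |u| ≤ 1) :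
    ‖(u : AddCircle (2 : ℝ))‖ = |u| := by
  rw [AddCircle.norm_coe_eq_abs_iff _ (by norm_num)]
  simpa using hu

lemma AddCircle.norm_coe_of_one_le {u : ℝ} (hu : 1 ≤ u) (hu' : u ≤ 2) :
    ‖(u : AddCircle (2 : ℝ))‖ = 2 - u := by
  have h1 : (u : AddCircle (2 : ℝ)) = ((u - 2 : ℝ) : AddCircle (2 : ℝ)) := by
    rw [AddCircle.coe_sub, AddCircle.coe_period, sub_zero]
  rw [h1, AddCircle.norm_coe_of_abs_le_one (abs_le.2 ⟨by linarith, by linarith⟩),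
    abs_of_nonpos (by linarith)]
  ring

lemma AddCircle.norm_coe_eq_min {u : ℝ} (hu : 0 ≤ u) (hu' : u ≤ 2) :
    ‖(u : AddCircle (2 : ℝ))‖ = min u (2 - u) := by
  rcases le_total u 1 with h1 | h1
  · rw [AddCircle.norm_coe_of_abs_le_one (abs_le.2 ⟨by linarith, h1⟩), abs_of_nonneg hu,
      min_eq_left (by linarith)]
  · rw [AddCircle.norm_coe_of_one_le h1 hu', min_eq_right (by linarith)]

lemma AddCircle.exists_coe_eq_norm (z : AddCircle (2 : ℝ)) :
    ∃ u : ℝ, (u : AddCircle (2 : ℝ)) = z ∧ ‖z‖ = |u| := by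
  have : Fact ((0 : ℝ) < 2) := ⟨by norm_num⟩
  obtain ⟨u, hu, rfl⟩ : ∃ u : ℝ, u ∈ Set.Ico (-1 : ℝ) (-1 + 2) ∧ (u : AddCircle (2 : ℝ)) = z :=
    ⟨_, (AddCircle.equivIco 2 (-1) z).2, (AddCircle.equivIco 2 (-1)).symm_apply_apply z⟩
  exact ⟨u, rfl, AddCircle.norm_coe_of_abs_le_one (abs_le.2 ⟨hu.1, by linarith [hu.2]⟩)⟩

namespace UniformUpTo

variable {Y : Type*} [MetricSpace Y] [MeasurableSpace Y] [BorelSpace Y] {μ : Measure Y} {J : Set ℝ}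

/-- Spheres of admissible radii are nonempty. -/
lemma exists_dist_eq [PreconnectedSpace Y] (h : UniformUpTo μ J) (x : Y) {a : ℝ} (ha : 0 < a)
    (haJ : a ∈ J) : ∃ p, dist x p = a := by
  obtain ⟨z, hz, -⟩ := h.exists_dist_mem_Ioo x ha.le (lt_add_one a) haJ
  have hzx : z ∈ ({x}ᶜ : Set Y) := by
    rintro rfl
    simp at hz
    linarith
  obtain ⟨p, -, hp⟩ := exists_mem_dist_eq_of_isClosed_insert (Q := {x}ᶜ) (y := x) (z := z)
    isOpen_compl_singleton (fun hx => hx rfl)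
    (by rw [Set.insert_eq, Set.union_compl_self]; exact isClosed_univ) hzx ha hz.le
  exact ⟨p, hp⟩

variable [ProperSpace Y]

open Classical in
/-- A connected 1-uniform space is isometric to the line. -/
theorem nonempty_isometryEquiv_real [ConnectedSpace Y] (h : UniformUpTo μ Set.univ) :
    Nonempty (Y ≃ᵢ ℝ) := by
  obtain ⟨x⟩ : Nonempty Y := inferInstance
  obtain ⟨A, hsame, hopp, hex⟩ := exists_sides (x := x) (Λ := Set.Ioi 0) (M := fun s t => s + t)
    ⟨1, by simp⟩
    (fun s hs t ht => by
      rw [Set.mem_Ioi] at hs ht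
      exact abs_lt.2 ⟨by linarith, by linarith⟩)
    (fun a ha => h.exists_dist_eq x ha (Set.mem_univ _))
    (fun p hp a ha => h.exists_same_opposite ha (Set.mem_univ _) hp (Set.mem_univ _)
      fun _ _ => Set.mem_univ _)
  set e : Y → ℝ := fun p => if p ∈ A then dist x p else -dist x p with he
  have habs : ∀ p, |e p| = dist x p := fun p => by
    simp only [he]
    split_ifs <;> simp
  have hiso : Isometry e := by
    refine Isometry.of_dist_eq fun p q => ?_
    rw [Real.dist_eq]
    rcases eq_or_ne x p with rfl | hxp
    · have h0 : e x = 0 := by simp [he]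
      rw [h0, zero_sub, abs_neg, habs]
    rcases eq_or_ne x q with rfl | hxq
    · have h0 : e x = 0 := by simp [he]
      rw [h0, sub_zero, habs, dist_comm]
    have hp := dist_pos.2 hxp
    have hq := dist_pos.2 hxq
    by_cases hpA : p ∈ A <;> by_cases hqA : q ∈ A
    · simp only [he, if_pos hpA, if_pos hqA]
      rw [hsame p q hp hq (by tauto)]
    · simp only [he, if_pos hpA, if_neg hqA]
      rw [hopp p q hp hq (by tauto), abs_of_pos (by linarith)]
      ring
    · simp only [he, if_neg hpA, if_pos hqA]
      rw [hopp p q hp hq (by tauto), abs_of_neg (by linarith)]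
      ring
    · simp only [he, if_neg hpA, if_neg hqA]
      rw [hsame p q hp hq (by tauto), ← abs_neg]
      ring_nf
  have hsurj : Function.Surjective e := by
    intro r
    rcases lt_trichotomy r 0 with hr | rfl | hr
    · obtain ⟨-, p, hpA, hp⟩ := hex (-r) (by simpa using hr)
      exact ⟨p, by simp [he, hpA, hp]⟩
    · exact ⟨x, by simp [he]⟩
    · obtain ⟨⟨p, hpA, hp⟩, -⟩ := hex r hr
      exact ⟨p, by simp [he, hpA, hp]⟩
  exact ⟨⟨Equiv.ofBijective e ⟨hiso.injective, hsurj⟩, hiso⟩⟩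

/-- In a connected space that is uniform up to its diameter `D` and has total measure `D`, each
point has an antipode, and every point lies on a geodesic between the two. -/
lemma exists_antipode [PreconnectedSpace Y] {D : ℝ} (hD : 0 < D)
    (h : UniformUpTo μ (Set.Iio D)) (hdiam : ∀ p q : Y, dist p q ≤ D)
    (huniv : μ Set.univ = ENNReal.ofReal D) (x : Y) :
    ∃ x', dist x x' = D ∧ ∀ p, dist p x' = D - dist x p := by
  obtain ⟨y, hy⟩ := h.exists_dist_eq x (half_pos hD) (by simpa using hD)
  have hbeyond : ∀ p, 0 < dist x p → ∃ z, dist x z = D ∧ dist p z = D - dist x p := by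
    intro p hp
    obtain ⟨z, hz, hz'⟩ := h.exists_beyond hp rfl (L := D - dist x p)
      (by linarith [hdiam x p]) fun u hu => by
        rw [Set.mem_Iio]
        linarith
    exact ⟨z, by linarith, hz'⟩
  obtain ⟨x', hx', -⟩ := hbeyond y (by rw [hy]; positivity)
  have huniq : ∀ z, dist x z = D → z = x' := by
    intro z hz
    by_contra hne
    have hd := dist_pos.2 hne
    set k := min D (dist z x') / 2 with hk
    have hk0 : 0 < k := by positivity
    have hkD : k < D := by
      have := min_le_left D (dist z x')
      linarith
    have hkd : 2 * k ≤ dist z x' := by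
      have := min_le_right D (dist z x')
      linarith
    have hsub : ∀ w, dist x w = D → ball w k ⊆ (closedBall x (D - k))ᶜ := by
      intro w hw v hv
      rw [Set.mem_compl_iff, mem_closedBall', not_le]
      rw [mem_ball] at hv
      have := dist_triangle x v w
      linarith
    have hS : μ (closedBall x (D - k))ᶜ = ENNReal.ofReal k := by
      have hcb := h.measure_closedBall x (r := D - k) (by linarith) (by
        rw [Set.mem_Iio]
        linarith)
      rw [measure_compl measurableSet_closedBall (by rw [hcb]; exact ENNReal.ofReal_ne_top),
        huniv, hcb, ← ENNReal.ofReal_sub _ (by linarith)]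
      congr 1
      ring
    have hempty := h.eq_empty_of_measure_le (U := ball z k) (V := ball x' k)
      (S := (closedBall x (D - k))ᶜ) isOpen_ball (ball_disjoint_ball (by linarith)) (hsub z hz)
      (hsub x' hx') (by rw [hS, h.measure_ball z k hk0 hkD]) (by
        rw [hS]
        exact ENNReal.ofReal_ne_top)
    have : x' ∈ ball x' k := mem_ball_self hk0
    rw [hempty] at this
    exact this
  refine ⟨x', hx', fun p => ?_⟩
  rcases eq_or_ne x p with rfl | hxp
  · rw [hx', dist_self, sub_zero]
  · obtain ⟨z, hz, hz'⟩ := hbeyond p (dist_pos.2 hxp)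
    rw [← huniq z hz, hz']

open Classical in
/-- A connected space that is uniform up to its diameter `D` and has total measure `D` is a circle
of length `2 * D`. -/
theorem exists_equiv_addCircle [ConnectedSpace Y] {D : ℝ} (hD : 0 < D)
    (h : UniformUpTo μ (Set.Iio D)) (hdiam : ∀ p q : Y, dist p q ≤ D)
    (huniv : μ Set.univ = ENNReal.ofReal D) :
    ∃ e : Y ≃ AddCircle (2 : ℝ), ∀ p q, dist p q = D * dist (e p) (e q) := by
  obtain ⟨x⟩ : Nonempty Y := inferInstance
  obtain ⟨x', hx', hanti⟩ := h.exists_antipode hD hdiam huniv x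
  have hanti' : ∀ q, ∃ q', dist x q' = D - dist x q ∧ ∀ p, dist p q' = D - dist q p := by
    intro q
    obtain ⟨q', h1, h2⟩ := h.exists_antipode hD hdiam huniv q
    exact ⟨q', by rw [h2 x, dist_comm q x], h2⟩
  -- For distances adding up to more than `D`, one of the two points is replaced by its antipode.
  obtain ⟨A, hsame, hopp, hex⟩ := exists_sides (x := x) (Λ := Set.Ioo 0 D)
    (M := fun s t => min (s + t) (2 * D - (s + t)))
    ⟨D / 2, by constructor <;> linarith⟩
    (fun s hs t ht => by
      have h1 := hs.1
      have h2 := hs.2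
      have h3 := ht.1
      have h4 := ht.2
      exact abs_lt.2 ⟨by rw [neg_lt, lt_min_iff]; constructor <;> linarith,
        by rw [lt_min_iff]; constructor <;> linarith⟩)
    (fun a ha => h.exists_dist_eq x ha.1 ha.2)
    (fun p hp a ha => by
      have h1 := hp.1
      have h2 := hp.2
      have h3 := ha.1
      have h4 := ha.2
      rcases le_total (a + dist x p) D with hle | hle
      · obtain ⟨q, q', h5, h6, h7, h8, h9⟩ := h.exists_same_opposite h3 h4 h1 h2 fun u hu => by
          rw [Set.mem_Iio]
          linarith
        exact ⟨q, q', h5, h6, h7, by rw [h8, min_eq_left (by linarith)], h9⟩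
      · rcases le_total a (dist x p) with hap | hap
        · obtain ⟨p', hp', hp''⟩ := hanti' p
          obtain ⟨q, q', h5, h6, h7, h8, h9⟩ := h.exists_same_opposite (x := x) (p := p') h3 h4
            (by linarith) (by rw [Set.mem_Iio]; linarith) fun u hu => by
              rw [Set.mem_Iio]
              linarith
          rw [dist_comm, hp''] at h7 h8
          rw [hp'] at h7 h8
          rw [abs_of_nonneg (by linarith)] at h7
          refine ⟨q', q, h6, h5, ?_, ?_, fun z hz => (h9 z hz).symm⟩
          · rw [abs_of_nonpos (by linarith)]
            linarith
          · rw [min_eq_right (by linarith)]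
            linarith
        · obtain ⟨q, q', h5, h6, h7, h8, h9⟩ := h.exists_same_opposite (x := x) (p := p)
            (a := D - a) (by linarith) (by rw [Set.mem_Iio]; linarith) h1 h2 fun u hu => by
              rw [Set.mem_Iio]
              linarith
          obtain ⟨r, hr, hr'⟩ := hanti' q
          obtain ⟨r', hr1, hr1'⟩ := hanti' q'
          rw [abs_of_nonpos (by linarith)] at h7
          have h10 := hr' p
          have h11 := hr1' p
          rw [dist_comm q p, h7] at h10
          rw [dist_comm q' p, h8] at h11
          have hne : r' ≠ r := by
            rintro rfl
            linarith
          refine ⟨r', r, by linarith, by linarith, ?_, ?_, fun z hz => ?_⟩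
          · rw [abs_of_nonneg (by linarith)]
            linarith
          · rw [min_eq_right (by linarith)]
            linarith
          · exact h.eq_or_eq_of_dist_eq h3 h4 (by linarith) (by linarith) hne hz)
  have hsame' : ∀ p q, (p ∈ A ↔ q ∈ A) → dist p q = |dist x p - dist x q| := by
    intro p q hpq
    rcases eq_or_ne x p with rfl | hxp
    · rw [dist_self, zero_sub, abs_neg, abs_of_nonneg dist_nonneg]
    rcases eq_or_ne x q with rfl | hxq
    · rw [dist_self, sub_zero, abs_of_nonneg dist_nonneg, dist_comm]
    rcases (hdiam x p).eq_or_lt with hp | hp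
    · have : dist p x' = 0 := by rw [hanti, hp, sub_self]
      rw [dist_eq_zero.1 this, hx', dist_comm, hanti, abs_of_nonneg (by linarith [hdiam x q])]
    rcases (hdiam x q).eq_or_lt with hq | hq
    · have : dist q x' = 0 := by rw [hanti, hq, sub_self]
      rw [dist_eq_zero.1 this, hx', hanti, abs_of_nonpos (by linarith [hdiam x p])]
      ring
    exact hsame p q ⟨dist_pos.2 hxp, hp⟩ ⟨dist_pos.2 hxq, hq⟩ hpq
  have hopp' : ∀ p q, ¬ (p ∈ A ↔ q ∈ A) →
      dist p q = min (dist x p + dist x q) (2 * D - (dist x p + dist x q)) := by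
    intro p q hpq
    have h1 := hdiam x p
    have h2 := hdiam x q
    rcases eq_or_ne x p with rfl | hxp
    · rw [dist_self, min_eq_left (by linarith), zero_add]
    rcases eq_or_ne x q with rfl | hxq
    · rw [dist_self, min_eq_left (by linarith), add_zero, dist_comm]
    rcases (hdiam x p).eq_or_lt with hp | hp
    · have : dist p x' = 0 := by rw [hanti, hp, sub_self]
      rw [dist_eq_zero.1 this, hx', dist_comm, hanti,
        min_eq_right (by linarith [@dist_nonneg _ _ x q])]
      ring
    rcases (hdiam x q).eq_or_lt with hq | hq
    · have : dist q x' = 0 := by rw [hanti, hq, sub_self]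
      rw [dist_eq_zero.1 this, hx', hanti, min_eq_right (by linarith [@dist_nonneg _ _ x p])]
      ring
    exact hopp p q ⟨dist_pos.2 hxp, hp⟩ ⟨dist_pos.2 hxq, hq⟩ hpq
  set f : Y → ℝ := fun p => if p ∈ A then dist x p / D else -(dist x p / D) with hf
  have hbound : ∀ p, 0 ≤ dist x p / D ∧ dist x p / D ≤ 1 := fun p =>
    ⟨by positivity, by rw [div_le_one hD]; exact hdiam x p⟩
  have hmin : ∀ p q : Y, D * min (dist x p / D + dist x q / D)
      (2 - (dist x p / D + dist x q / D)) =
      min (dist x p + dist x q) (2 * D - (dist x p + dist x q)) := by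
    intro p q
    rw [mul_min_of_nonneg _ _ hD.le]
    congr 1 <;> field_simp
  have hdist : ∀ p q, dist p q =
      D * dist (f p : AddCircle (2 : ℝ)) (f q : AddCircle (2 : ℝ)) := by
    intro p q
    have h1 := hbound p
    have h2 := hbound q
    rw [dist_eq_norm, ← AddCircle.coe_sub]
    by_cases hpA : p ∈ A <;> by_cases hqA : q ∈ A
    · simp only [hf, if_pos hpA, if_pos hqA]
      rw [AddCircle.norm_coe_of_abs_le_one (abs_le.2 ⟨by linarith, by linarith⟩), ← sub_div,
        abs_div, abs_of_pos hD, mul_div_cancel₀ _ hD.ne']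
      exact hsame' p q (by tauto)
    · simp only [hf, if_pos hpA, if_neg hqA]
      rw [sub_neg_eq_add, AddCircle.norm_coe_eq_min (by linarith) (by linarith), hmin,
        hopp' p q (by tauto)]
    · simp only [hf, if_neg hpA, if_pos hqA]
      rw [← norm_neg, ← AddCircle.coe_neg, neg_sub, sub_neg_eq_add,
        AddCircle.norm_coe_eq_min (by linarith) (by linarith), add_comm (dist x q / D), hmin,
        hopp' p q (by tauto)]
    · simp only [hf, if_neg hpA, if_neg hqA]
      rw [AddCircle.norm_coe_of_abs_le_one (abs_le.2 ⟨by linarith, by linarith⟩), neg_sub_neg,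
        ← sub_div, abs_div, abs_of_pos hD, mul_div_cancel₀ _ hD.ne', abs_sub_comm]
      exact hsame' p q (by tauto)
  have hinj : Function.Injective fun p => (f p : AddCircle (2 : ℝ)) := by
    intro p q hpq
    have hpq' : (f p : AddCircle (2 : ℝ)) = (f q : AddCircle (2 : ℝ)) := hpq
    have := hdist p q
    rw [hpq', dist_self, mul_zero] at this
    exact dist_eq_zero.1 this
  have hsurj : Function.Surjective fun p => (f p : AddCircle (2 : ℝ)) := by
    intro c
    have : Fact ((0 : ℝ) < 2) := ⟨by norm_num⟩
    obtain ⟨u, hu, rfl⟩ : ∃ u : ℝ, u ∈ Set.Ico (-1 : ℝ) (-1 + 2) ∧ (u : AddCircle (2 : ℝ)) = c :=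
      ⟨_, (AddCircle.equivIco 2 (-1) c).2, (AddCircle.equivIco 2 (-1)).symm_apply_apply c⟩
    have hu1 := hu.1
    have hu2 := hu.2
    rcases lt_trichotomy u 0 with h0 | rfl | h0
    · rcases hu1.eq_or_lt with h1 | h1
      · refine ⟨x', ?_⟩
        have hf' : f x' = 1 ∨ f x' = -1 := by
          simp only [hf, hx', div_self hD.ne']
          exact ite_eq_or_eq _ _ _
        rcases hf' with hf' | hf'
        · simp only [hf']
          rw [← h1, ← sub_eq_zero, ← AddCircle.coe_sub]
          norm_num
        · simp only [hf', h1]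
      · obtain ⟨-, p, hpA, hp⟩ := hex (D * -u) ⟨by nlinarith, by nlinarith⟩
        refine ⟨p, ?_⟩
        simp only [hf, if_neg hpA, hp]
        rw [mul_div_cancel_left₀ _ hD.ne', neg_neg]
    · refine ⟨x, ?_⟩
      simp [hf]
    · obtain ⟨⟨p, hpA, hp⟩, -⟩ := hex (D * u) ⟨by positivity, by nlinarith⟩
      refine ⟨p, ?_⟩
      simp only [hf, if_pos hpA, hp]
      rw [mul_div_cancel_left₀ _ hD.ne']
  exact ⟨Equiv.ofBijective _ ⟨hinj, hsurj⟩, hdist⟩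

end UniformUpTo

/-! ### Cells -/

/-- A cell of size `ρ`: a nonempty set that, seen from each of its points, lies between the open
and the closed ball of radius `ρ`. The two halves of a Besicovitch pair are cells. -/
structure IsCell {X : Type*} [MetricSpace X] (ρ : ℝ) (C : Set X) : Prop where
  pos : 0 < ρ
  nonempty : C.Nonempty
  ball_subset : ∀ x ∈ C, ball x ρ ⊆ C
  subset_closedBall : ∀ x ∈ C, C ⊆ closedBall x ρ

namespace IsCell

variable {X : Type*} [MetricSpace X] {ρ : ℝ} {C C' : Set X}

lemma isOpen (hC : IsCell ρ C) : IsOpen C :=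
  Metric.isOpen_iff.2 fun x hx => ⟨ρ, hC.pos, hC.ball_subset x hx⟩

lemma le_dist (hC : IsCell ρ C) {x y : X} (hx : x ∈ C) (hy : y ∉ C) : ρ ≤ dist x y := by
  by_contra hlt
  exact hy (hC.ball_subset x hx (mem_ball'.2 (not_le.1 hlt)))

lemma dist_le (hC : IsCell ρ C) {x y : X} (hx : x ∈ C) (hy : y ∈ C) : dist x y ≤ ρ :=
  mem_closedBall'.1 (hC.subset_closedBall x hx hy)

lemma isClosed (hC : IsCell ρ C) : IsClosed C := by
  rw [← closure_subset_iff_isClosed]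
  intro z hz
  obtain ⟨x, hx, hzx⟩ := Metric.mem_closure_iff.1 hz ρ hC.pos
  exact hC.ball_subset x hx hzx

lemma isBounded (hC : IsCell ρ C) : Bornology.IsBounded C := by
  obtain ⟨x, hx⟩ := hC.nonempty
  exact isBounded_closedBall.subset (hC.subset_closedBall x hx)

lemma mem_closure_ball {x : X} (hC : IsCell ρ (closure (ball x ρ))) : x ∈ closure (ball x ρ) :=
  subset_closure (mem_ball_self hC.pos)

variable [MeasurableSpace X] {μ : Measure X}

lemma measure_eq (hC : IsCell ρ C) (h : UniformUpTo μ Set.univ) : μ C = ENNReal.ofReal ρ := by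
  obtain ⟨x, hx⟩ := hC.nonempty
  apply le_antisymm
  · rw [← h.measure_closedBall x hC.pos.le (Set.mem_univ _)]
    exact measure_mono (hC.subset_closedBall x hx)
  · rw [← h.measure_ball x ρ hC.pos (Set.mem_univ _)]
    exact measure_mono (hC.ball_subset x hx)

variable [BorelSpace X]

/-- Balls of radius `ρ` are dense in a cell of size `ρ`, since they have the same measure. -/
lemma eq_closure_ball (hC : IsCell ρ C) (h : UniformUpTo μ Set.univ) {x : X} (hx : x ∈ C) :
    C = closure (ball x ρ) := by
  apply Set.Subset.antisymm
  · rw [← Set.sdiff_eq_empty]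
    refine h.eq_empty_of_measure_le (U := ball x ρ) (S := C) (hC.isOpen.sdiff isClosed_closure)
      (Set.disjoint_of_subset_left subset_closure Set.disjoint_sdiff_right)
      (hC.ball_subset x hx) Set.sdiff_subset ?_ ?_
    · rw [hC.measure_eq h, h.measure_ball x ρ hC.pos (Set.mem_univ _)]
    · rw [hC.measure_eq h]
      exact ENNReal.ofReal_ne_top
  · exact closure_minimal (hC.ball_subset x hx) hC.isClosed

end IsCell

section BesicovitchPair

variable {X : Type*} [MetricSpace X]

lemma IsBesicovitchPair.symm {a b : X} (hab : IsBesicovitchPair a b) : IsBesicovitchPair b a := by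
  refine ⟨hab.1.symm, fun x hx y hy => ?_⟩
  rw [dist_comm b a] at hx hy ⊢
  rw [dist_comm x y]
  exact hab.2 y hy x hx

/-- A point of a cell and a point outside it at the smallest possible distance form a Besicovitch
pair. -/
lemma IsCell.isBesicovitchPair {ρ : ℝ} {C : Set X} (hC : IsCell ρ C) {x y : X} (hx : x ∈ C)
    (hy : y ∉ C) (hxy : dist x y = ρ) : IsBesicovitchPair x y := by
  refine ⟨fun heq => hy (heq ▸ hx), fun z hz w hw => ?_⟩
  rw [hxy] at hz hw ⊢
  have hzC := hC.ball_subset x hx hz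
  refine hC.le_dist hzC fun hwC => ?_
  have := hC.le_dist hwC hy
  rw [mem_ball] at hw
  linarith

variable [MeasurableSpace X] [BorelSpace X] {μ : Measure X}

/-- The closed halves of a Besicovitch pair are cells: the two halves use up the measure of the
ball of twice the radius. -/
lemma IsBesicovitchPair.isCell (h : UniformUpTo μ Set.univ) {a b : X}
    (hab : IsBesicovitchPair a b) : IsCell (dist a b) (closure (ball a (dist a b))) := by
  set δ := dist a b with hδ
  have hδ0 : 0 < δ := dist_pos.2 hab.1
  have hsep := hab.2
  have hdisj : Disjoint (ball a δ) (ball b δ) := by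
    rw [Set.disjoint_left]
    intro z hz hz'
    have := hsep z hz z hz'
    rw [dist_self] at this
    linarith
  have hcover : ball a (2 * δ) ⊆ closure (ball a δ ∪ ball b δ) := by
    rw [← Set.sdiff_eq_empty]
    refine h.eq_empty_of_measure_le (U := ball a δ ∪ ball b δ) (S := ball a (2 * δ))
      (isOpen_ball.sdiff isClosed_closure)
      (Set.disjoint_of_subset_left subset_closure Set.disjoint_sdiff_right)
      (Set.union_subset (ball_subset_ball (by linarith)) ?_) Set.sdiff_subset ?_ ?_
    · intro z hz
      rw [mem_ball'] at hz ⊢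
      have := dist_triangle a b z
      linarith
    · rw [measure_union hdisj measurableSet_ball, h.measure_ball a _ (by linarith)
        (Set.mem_univ _), h.measure_ball a _ hδ0 (Set.mem_univ _),
        h.measure_ball b _ hδ0 (Set.mem_univ _), ← ENNReal.ofReal_add hδ0.le hδ0.le, two_mul]
    · rw [h.measure_ball a _ (by linarith) (Set.mem_univ _)]
      exact ENNReal.ofReal_ne_top
  have hball : ∀ x ∈ ball a δ, ball x δ ⊆ closure (ball a δ) := by
    intro x hx z hz
    have h1 : z ∈ ball a (2 * δ) := by
      rw [mem_ball] at hx hz ⊢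
      have := dist_triangle z x a
      linarith
    have h2 := hcover h1
    rw [closure_union] at h2
    refine h2.resolve_right fun h3 => ?_
    obtain ⟨w, hw, hw'⟩ := mem_closure_iff.1 h3 (ball x δ) isOpen_ball hz
    have := hsep x hx w hw'
    rw [mem_ball'] at hw
    linarith
  have hball' : ∀ x ∈ closure (ball a δ), ball x δ ⊆ closure (ball a δ) := by
    intro x hx z hz
    rw [mem_ball'] at hz
    obtain ⟨w, hw, hxw⟩ := Metric.mem_closure_iff.1 hx (δ - dist x z) (by linarith)
    refine hball w hw ?_
    rw [mem_ball']
    have := dist_triangle w x z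
    rw [dist_comm w x] at this
    linarith
  have ha : a ∈ closure (ball a δ) := subset_closure (mem_ball_self hδ0)
  have hopen : IsOpen (closure (ball a δ)) :=
    Metric.isOpen_iff.2 fun x hx => ⟨δ, hδ0, hball' x hx⟩
  have hmeas : μ (closure (ball a δ)) ≤ ENNReal.ofReal δ := by
    rw [← h.measure_closedBall a hδ0.le (Set.mem_univ _)]
    exact measure_mono closure_ball_subset_closedBall
  refine ⟨hδ0, ⟨a, ha⟩, hball', fun x hx => ?_⟩
  rw [← Set.sdiff_eq_empty]
  refine h.eq_empty_of_measure_le (U := ball x δ) (S := closure (ball a δ))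
    (hopen.sdiff isClosed_closedBall)
    (Set.disjoint_of_subset_left ball_subset_closedBall Set.disjoint_sdiff_right)
    (hball' x hx) Set.sdiff_subset ?_ (hmeas.trans_lt ENNReal.ofReal_lt_top).ne
  rwa [h.measure_ball x _ hδ0 (Set.mem_univ _)]

end BesicovitchPair

namespace IsCell

variable {X : Type*} [MetricSpace X] [MeasurableSpace X] [BorelSpace X] {μ : Measure X} {ρ : ℝ}
  {C C' : Set X}

/-- From each point of a cell of size `ρ`, the complement is at distance exactly `ρ`. -/
lemma exists_notMem_dist_eq [ProperSpace X] (hC : IsCell ρ C) (h : UniformUpTo μ Set.univ) {x : X}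
    (hx : x ∈ C) : ∃ y, y ∉ C ∧ dist x y = ρ := by
  have hne : (Cᶜ).Nonempty := by
    obtain ⟨y, hy, -⟩ := h.exists_dist_mem_Ioo x hC.pos.le (lt_add_one ρ) (Set.mem_univ _)
    exact ⟨y, fun hyC => absurd (hC.dist_le hx hyC) (not_le.2 hy)⟩
  obtain ⟨y, hy, hxy⟩ := hC.isOpen.isClosed_compl.exists_infDist_eq_dist hne x
  refine ⟨y, hy, le_antisymm ?_ (hC.le_dist hx hy)⟩
  refine le_of_forall_pos_le_add fun ε hε => ?_
  obtain ⟨z, hz, hz'⟩ := h.exists_dist_mem_Ioo x hC.pos.le (lt_add_of_pos_right ρ hε)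
    (Set.mem_univ _)
  have hzC : z ∈ Cᶜ := fun hzC => absurd (hC.dist_le hx hzC) (not_le.2 hz)
  rw [← hxy]
  exact (infDist_le_dist_of_mem hzC).trans hz'.le

/-- Two neighbouring cells fill the ball of twice the radius about `x`, because `C` and the ball
about `y` have the measure of that ball. -/
lemma ball_two_mul_subset (hC : IsCell ρ C) (hC' : IsCell ρ C') (hdisj : Disjoint C C')
    (h : UniformUpTo μ Set.univ) {x y : X} (hx : x ∈ C) (hy : y ∈ C') (hxy : dist x y = ρ) :
    ball x (2 * ρ) ⊆ C ∪ C' := by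
  have hρ := hC.pos
  rw [← Set.sdiff_eq_empty]
  refine h.eq_empty_of_measure_le (U := C ∪ ball y ρ) (S := ball x (2 * ρ))
    (isOpen_ball.sdiff (hC.isClosed.union hC'.isClosed))
    (Set.disjoint_of_subset_left (Set.union_subset_union_right _ (hC'.ball_subset y hy))
      Set.disjoint_sdiff_right)
    (Set.union_subset ((hC.subset_closedBall x hx).trans
      (closedBall_subset_ball (by linarith))) fun z hz => ?_) Set.sdiff_subset ?_ ?_
  · rw [mem_ball'] at hz ⊢
    have := dist_triangle x y z
    linarith
  · rw [measure_union (hdisj.mono_right (hC'.ball_subset y hy)) measurableSet_ball,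
      hC.measure_eq h, h.measure_ball y _ hρ (Set.mem_univ _),
      h.measure_ball x _ (by linarith) (Set.mem_univ _), ← ENNReal.ofReal_add hρ.le hρ.le, two_mul]
  · rw [h.measure_ball x _ (by linarith) (Set.mem_univ _)]
    exact ENNReal.ofReal_ne_top

/-- The distance from `x` to a point of the neighbouring cell is realised through the partner `x'`
of `x`: by their measures, `C` and the ball of radius `s` about `x'` leave no room for anything else
in the ball of radius `ρ + s` about `x`. -/
lemma dist_eq_add (hC : IsCell ρ C) (hC' : IsCell ρ C') (hdisj : Disjoint C C')
    (h : UniformUpTo μ Set.univ) {x x' y : X} (hx : x ∈ C) (hx' : x' ∈ C') (hxx' : dist x x' = ρ)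
    (hy : y ∈ C') : dist x y = ρ + dist x' y := by
  have hρ := hC.pos
  refine le_antisymm (hxx' ▸ dist_triangle x x' y) ?_
  by_contra hlt
  rw [not_le] at hlt
  have hρxy : ρ ≤ dist x y := hC.le_dist hx fun hyC => Set.disjoint_left.1 hdisj hyC hy
  obtain ⟨s, hs1, hs2⟩ := exists_between (show dist x y - ρ < dist x' y by linarith)
  have hs0 : 0 < s := by linarith
  have hsρ : s < ρ := hs2.trans_le (hC'.dist_le hx' hy)
  have hsub : ball x' s ⊆ C' := (ball_subset_ball hsρ.le).trans (hC'.ball_subset x' hx')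
  have hempty := h.eq_empty_of_measure_le (U := C ∪ ball x' s)
    (V := (C' ∩ ball x (ρ + s)) \ closedBall x' s) (S := ball x (ρ + s))
    ((hC'.isOpen.inter isOpen_ball).sdiff isClosed_closedBall)
    (by
      rw [Set.disjoint_union_left]
      exact ⟨hdisj.mono_right (Set.sdiff_subset.trans Set.inter_subset_left),
        Set.disjoint_of_subset_left ball_subset_closedBall Set.disjoint_sdiff_right⟩)
    (Set.union_subset ((hC.subset_closedBall x hx).trans
      (closedBall_subset_ball (by linarith))) fun z hz => by
        rw [mem_ball'] at hz ⊢
        have := dist_triangle x x' z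
        linarith)
    (Set.sdiff_subset.trans Set.inter_subset_right)
    (by
      rw [measure_union (hdisj.mono_right hsub) measurableSet_ball, hC.measure_eq h,
        h.measure_ball x' _ hs0 (Set.mem_univ _),
        h.measure_ball x _ (by linarith) (Set.mem_univ _), ← ENNReal.ofReal_add hρ.le hs0.le])
    (by
      rw [h.measure_ball x _ (by linarith) (Set.mem_univ _)]
      exact ENNReal.ofReal_ne_top)
  have : y ∈ (C' ∩ ball x (ρ + s)) \ closedBall x' s := by
    refine ⟨⟨hy, ?_⟩, ?_⟩
    · rw [mem_ball']
      linarith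
    · rw [mem_closedBall', not_le]
      exact hs2
  rw [hempty] at this
  exact this

variable [ProperSpace X]

/-- If one point of `C` is at the smallest possible distance from `C'`, then so is every point. This
holds in the ball about the one point, and that ball is dense in `C`. -/
lemma forall_exists_partner (hC : IsCell ρ C) (hC' : IsCell ρ C') (hdisj : Disjoint C C')
    (h : UniformUpTo μ Set.univ) {x y : X} (hx : x ∈ C) (hy : y ∈ C') (hxy : dist x y = ρ) :
    ∀ z ∈ C, ∃ w ∈ C', dist z w = ρ := by
  have hball : ∀ z ∈ ball x ρ, ∃ w ∈ C', dist z w = ρ := by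
    intro z hz
    obtain ⟨w, hw, hzw⟩ := hC.exists_notMem_dist_eq h (hC.ball_subset x hx hz)
    refine ⟨w, (hC.ball_two_mul_subset hC' hdisj h hx hy hxy ?_).resolve_left hw, hzw⟩
    rw [mem_ball'] at hz ⊢
    have := dist_triangle x z w
    linarith
  have hcpt : IsCompact C' := by
    obtain ⟨y, hy⟩ := hC'.nonempty
    exact (isCompact_closedBall y ρ).of_isClosed_subset hC'.isClosed (hC'.subset_closedBall y hy)
  intro z hz
  obtain ⟨w, hw, hzw⟩ := hcpt.exists_infDist_eq_dist hC'.nonempty z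
  refine ⟨w, hw, ?_⟩
  rw [← hzw]
  have hcl : IsClosed {z | infDist z C' = ρ} :=
    isClosed_eq (continuous_infDist_pt C') continuous_const
  refine (closure_minimal (fun v hv => ?_) hcl : closure (ball x ρ) ⊆ _)
    (hC.eq_closure_ball h hx ▸ hz)
  obtain ⟨u, hu, hvu⟩ := hball v hv
  refine le_antisymm (hvu ▸ infDist_le_dist_of_mem hu) ?_
  refine (le_infDist hC'.nonempty).2 fun u' hu' => ?_
  exact hC.le_dist (hC.ball_subset x hx hv) fun hu'' => Set.disjoint_left.1 hdisj hu'' hu'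

/-- Two disjoint cells of size `ρ`, at distance `ρ` from each other, unite to a cell of twice the
size. -/
lemma union (hC : IsCell ρ C) (hC' : IsCell ρ C') (hdisj : Disjoint C C')
    (h : UniformUpTo μ Set.univ) {x y : X} (hx : x ∈ C) (hy : y ∈ C') (hxy : dist x y = ρ) :
    IsCell (2 * ρ) (C ∪ C') := by
  have hρ := hC.pos
  have hball : ∀ z ∈ C ∪ C', ball z (2 * ρ) ⊆ C ∪ C' := by
    rintro z (hz | hz)
    · obtain ⟨w, hw, hzw⟩ := hC.forall_exists_partner hC' hdisj h hx hy hxy z hz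
      exact hC.ball_two_mul_subset hC' hdisj h hz hw hzw
    · obtain ⟨w, hw, hzw⟩ := hC'.forall_exists_partner hC hdisj.symm h hy hx
        (by rw [dist_comm, hxy]) z hz
      rw [Set.union_comm]
      exact hC'.ball_two_mul_subset hC hdisj.symm h hz hw hzw
  have hmeas : μ (C ∪ C') = ENNReal.ofReal (2 * ρ) := by
    rw [measure_union hdisj hC'.isOpen.measurableSet, hC.measure_eq h, hC'.measure_eq h,
      ← ENNReal.ofReal_add hρ.le hρ.le, two_mul]
  refine ⟨by linarith, hC.nonempty.inl, hball, fun z hz => ?_⟩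
  rw [← Set.sdiff_eq_empty]
  refine h.eq_empty_of_measure_le (U := ball z (2 * ρ)) (S := C ∪ C')
    ((hC.isOpen.union hC'.isOpen).sdiff isClosed_closedBall)
    (Set.disjoint_of_subset_left ball_subset_closedBall Set.disjoint_sdiff_right)
    (hball z hz) Set.sdiff_subset ?_ ?_
  · rw [hmeas, h.measure_ball z _ (by linarith) (Set.mem_univ _)]
  · rw [hmeas]
    exact ENNReal.ofReal_ne_top

/-- Every cell has a neighbour at distance equal to its size. -/
lemma exists_neighbour (hC : IsCell ρ C) (h : UniformUpTo μ Set.univ) :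
    ∃ C', IsCell ρ C' ∧ Disjoint C C' ∧ ∃ x ∈ C, ∃ y ∈ C', dist x y = ρ := by
  obtain ⟨x, hx⟩ := hC.nonempty
  obtain ⟨y, hy, hxy⟩ := hC.exists_notMem_dist_eq h hx
  have hpair := (hC.isBesicovitchPair hx hy hxy).symm
  have hC' := hpair.isCell h
  rw [dist_comm, hxy] at hC'
  refine ⟨_, hC', ?_, x, hx, y, hC'.mem_closure_ball, hxy⟩
  rw [Set.disjoint_left]
  intro z hz hz'
  have hz2 := hC'.eq_closure_ball h hz'
  have hz3 := hC.eq_closure_ball h hz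
  exact hy (by rw [hz3, ← hz2]; exact hC'.mem_closure_ball)

/-- A cell and one of its neighbours unite to the cell of twice the size about any of its points. -/
lemma two_mul (hC : IsCell ρ C) (h : UniformUpTo μ Set.univ) {o : X} (ho : o ∈ C) :
    IsCell (2 * ρ) (closure (ball o (2 * ρ))) := by
  obtain ⟨C', hC', hdisj, x, hx, y, hy, hxy⟩ := hC.exists_neighbour h
  have hU := hC.union hC' hdisj h hx hy hxy
  rw [← hU.eq_closure_ball h (Or.inl ho)]
  exact hU

end IsCell

/-! ### Folding a space onto a cell -/

lemma digitDist_update_left {k : ℕ → ℤ} {s t : ℕ → Bool} {N : ℕ}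
    (hst : Summable fun i => (2 : ℝ) ^ k i * |digit (s i) - digit (t i)|)
    (hs : s N = false) (ht : t N = false) :
    digitDist k (Function.update s N true) t = 2 ^ k N + digitDist k s t := by
  have h1 := hst.hasSum.update N ((2 : ℝ) ^ k N)
  have h2 : Function.update (fun i => (2 : ℝ) ^ k i * |digit (s i) - digit (t i)|) N (2 ^ k N) =
      fun i => (2 : ℝ) ^ k i * |digit (Function.update s N true i) - digit (t i)| := by
    funext i
    rcases eq_or_ne i N with rfl | hi
    · simp [digit, ht]
    · simp [hi]
  rw [h2] at h1
  rw [digitDist, h1.tsum_eq, hs, ht, digitDist]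
  simp

lemma digitDist_update_update (k : ℕ → ℤ) {s t : ℕ → Bool} {N : ℕ} (hs : s N = false)
    (ht : t N = false) :
    digitDist k (Function.update s N true) (Function.update t N true) = digitDist k s t := by
  unfold digitDist
  congr 1
  funext i
  rcases eq_or_ne i N with rfl | hi
  · simp [hs, ht]
  · simp [hi]

lemma summable_digit_of_eq_false {k : ℕ → ℤ} {s t : ℕ → Bool} {N : ℕ}
    (hs : ∀ j, N ≤ j → s j = false) (ht : ∀ j, N ≤ j → t j = false) :
    Summable fun i => (2 : ℝ) ^ k i * |digit (s i) - digit (t i)| := by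
  apply summable_of_ne_finset_zero (s := Finset.range N)
  intro j hj
  have hj' : N ≤ j := by simpa using hj
  rw [hs j hj', ht j hj']
  simp

section Fold

variable {X : Type*} [MetricSpace X]

open Classical in
/-- The partner of `x` at scale `r`: a point at distance `r` from `x` outside the cell of size `r`
of `x`. It is unique when there is such a cell, and `x` itself serves as a junk value. -/
noncomputable def partner (r : ℝ) (x : X) : X :=
  if h : ∃ y, y ∉ closure (ball x r) ∧ dist x y = r then h.choose else x

open Classical in
/-- The cell of size `2 ^ N * ρ` of `o` consists of two neighbouring cells of half the size.
Folding the one that does not contain `o` onto the other one, `N` times in succession, takes a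
point to the cell of size `ρ` of `o`; the digits record in which steps the point was moved. -/
noncomputable def fold (ρ : ℝ) (o : X) : ℕ → X → X × (ℕ → Bool)
  | 0, x => (x, fun _ => false)
  | N + 1, x =>
    if x ∈ closure (ball o (2 ^ N * ρ)) then fold ρ o N x
    else ((fold ρ o N (partner (2 ^ N * ρ) x)).1,
      Function.update (fold ρ o N (partner (2 ^ N * ρ) x)).2 N true)

lemma fold_succ_of_mem {ρ : ℝ} {o : X} {N : ℕ} {x : X} (hx : x ∈ closure (ball o (2 ^ N * ρ))) :
    fold ρ o (N + 1) x = fold ρ o N x := by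
  rw [fold, if_pos hx]

lemma fold_succ_of_notMem {ρ : ℝ} {o : X} {N : ℕ} {x : X}
    (hx : x ∉ closure (ball o (2 ^ N * ρ))) :
    fold ρ o (N + 1) x = ((fold ρ o N (partner (2 ^ N * ρ) x)).1,
      Function.update (fold ρ o N (partner (2 ^ N * ρ) x)).2 N true) := by
  rw [fold, if_neg hx]

lemma fold_eq_of_le {ρ : ℝ} (hρ : 0 < ρ) {o x : X} {N M : ℕ} (hNM : N ≤ M)
    (hx : x ∈ closure (ball o (2 ^ N * ρ))) : fold ρ o M x = fold ρ o N x := by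
  induction M, hNM using Nat.le_induction with
  | base => rfl
  | succ M hNM ih =>
    rw [← ih]
    refine fold_succ_of_mem (closure_mono (ball_subset_ball ?_) hx)
    gcongr
    norm_num

lemma exists_mem_closure_ball_two_pow {ρ : ℝ} (hρ : 0 < ρ) (o x : X) :
    ∃ N : ℕ, x ∈ closure (ball o (2 ^ N * ρ)) := by
  obtain ⟨N, hN⟩ := pow_unbounded_of_one_lt (dist o x / ρ) (one_lt_two (α := ℝ))
  refine ⟨N, subset_closure ?_⟩
  rw [mem_ball', ← div_lt_iff₀ hρ]
  exact hN

open Classical in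
/-- The result of folding a point `x` onto the cell of size `ρ` of `o`, with as many steps as `x`
requires. -/
noncomputable def foldAll (ρ : ℝ) (o x : X) : X × (ℕ → Bool) :=
  if h : ∃ N : ℕ, x ∈ closure (ball o (2 ^ N * ρ)) then fold ρ o h.choose x
  else (x, fun _ => false)

lemma foldAll_eq {ρ : ℝ} (hρ : 0 < ρ) {o x : X} {N : ℕ}
    (hx : x ∈ closure (ball o (2 ^ N * ρ))) : foldAll ρ o x = fold ρ o N x := by
  have h : ∃ N : ℕ, x ∈ closure (ball o (2 ^ N * ρ)) := ⟨N, hx⟩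
  rw [foldAll, dif_pos h]
  rcases le_total h.choose N with hle | hle
  · exact (fold_eq_of_le hρ hle h.choose_spec).symm
  · exact fold_eq_of_le hρ hle hx

/-- Folding onto a cell and folding onto the cell of twice the size record the same digits, up to a
shift. -/
lemma fold_succ_snd_succ (ρ : ℝ) (o x : X) (N j : ℕ) :
    (fold ρ o (N + 1) x).2 (j + 1) = (fold (2 * ρ) o N x).2 j := by
  induction N generalizing x j with
  | zero =>
    by_cases hx : x ∈ closure (ball o (2 ^ 0 * ρ))
    · rw [fold_succ_of_mem hx]
      rfl
    · rw [fold_succ_of_notMem hx]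
      simp [fold]
  | succ N ih =>
    have hscale : (2 : ℝ) ^ (N + 1) * ρ = 2 ^ N * (2 * ρ) := by ring
    by_cases hx : x ∈ closure (ball o (2 ^ (N + 1) * ρ))
    · rw [fold_succ_of_mem hx, ih, fold_succ_of_mem (by rwa [← hscale])]
    · rw [fold_succ_of_notMem hx, fold_succ_of_notMem (ρ := 2 * ρ) (by rwa [← hscale])]
      simp only
      rw [← hscale]
      rcases eq_or_ne j N with rfl | hj
      · simp
      · rw [Function.update_of_ne (by omega), Function.update_of_ne hj, ih]

lemma foldAll_snd_succ {ρ : ℝ} (hρ : 0 < ρ) (o x : X) (j : ℕ) :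
    (foldAll ρ o x).2 (j + 1) = (foldAll (2 * ρ) o x).2 j := by
  obtain ⟨N, hN⟩ := exists_mem_closure_ball_two_pow (ρ := 2 * ρ) (by positivity) o x
  have hN' : x ∈ closure (ball o (2 ^ (N + 1) * ρ)) := by
    rwa [pow_succ, mul_assoc]
  rw [foldAll_eq hρ hN', foldAll_eq (by positivity) hN, fold_succ_snd_succ]

variable [ProperSpace X] [MeasurableSpace X] [BorelSpace X] {μ : Measure X}

/-- The cell of size `2 * r` consists of the cell of size `r` and a neighbour. Taking partners maps
the neighbour isometrically onto the cell, and adds `r` to the distances between the two. -/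
lemma IsCell.partner_spec {r : ℝ} {o : X} (hC : IsCell r (closure (ball o r)))
    (h : UniformUpTo μ Set.univ) :
    (∀ x ∈ closure (ball o (2 * r)), x ∉ closure (ball o r) →
      partner r x ∈ closure (ball o r) ∧
      (∀ y ∈ closure (ball o r), dist x y = r + dist (partner r x) y) ∧
      ∀ y ∈ closure (ball o (2 * r)), y ∉ closure (ball o r) →
        dist x y = dist (partner r x) (partner r y)) ∧
    ∀ z ∈ closure (ball o r), ∃ x ∈ closure (ball o (2 * r)), x ∉ closure (ball o r) ∧
      partner r x = z := by
  set C := closure (ball o r) with hCdef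
  have hr := hC.pos
  obtain ⟨C', hC', hdisj, a, ha, b, hb, hab⟩ := hC.exists_neighbour h
  have hba : dist b a = r := by rw [dist_comm, hab]
  have hU := hC.union hC' hdisj h ha hb hab
  have hD : closure (ball o (2 * r)) = C ∪ C' :=
    (hU.eq_closure_ball h (Or.inl hC.mem_closure_ball)).symm
  have hnot : ∀ x ∈ C', x ∉ C := fun x hx hx' => Set.disjoint_left.1 hdisj hx' hx
  have hspec : ∀ x ∈ C', partner r x ∈ C ∧ dist x (partner r x) = r := by
    intro x hx
    have hex : ∃ y, y ∉ closure (ball x r) ∧ dist x y = r := by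
      rw [← hC'.eq_closure_ball h hx]
      exact hC'.exists_notMem_dist_eq h hx
    have heq : partner r x = hex.choose := by
      rw [partner, dif_pos hex]
    obtain ⟨h1, h2⟩ := hex.choose_spec
    rw [← heq] at h1 h2
    rw [← hC'.eq_closure_ball h hx] at h1
    refine ⟨?_, h2⟩
    have h3 : partner r x ∈ ball x (2 * r) := by
      rw [mem_ball', h2]
      linarith
    exact (hU.ball_subset x (Or.inr hx) h3).resolve_right h1
  have hadd : ∀ x ∈ C', ∀ y ∈ C, dist x y = r + dist (partner r x) y := fun x hx y hy =>
    hC'.dist_eq_add hC hdisj.symm h hx (hspec x hx).1 (hspec x hx).2 hy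
  rw [hD]
  refine ⟨fun x hx hxC => ?_, fun z hz => ?_⟩
  · have hx' := hx.resolve_left hxC
    refine ⟨(hspec x hx').1, hadd x hx', fun y hy hyC => ?_⟩
    have hy' := hy.resolve_left hyC
    have h1 := hadd x hx' _ (hspec y hy').1
    have h2 := hC.dist_eq_add hC' hdisj h (hspec y hy').1 hy'
      (by rw [dist_comm]; exact (hspec y hy').2) hx'
    rw [dist_comm (partner r y) x, dist_comm y x] at h2
    linarith
  · obtain ⟨x, hx, hzx⟩ := hC.forall_exists_partner hC' hdisj h ha hb hab z hz
    refine ⟨x, Or.inr hx, hnot x hx, ?_⟩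
    have h1 := hadd x hx z hz
    rw [dist_comm x z] at h1
    exact dist_eq_zero.1 (by linarith)

lemma IsCell.two_pow_mul {ρ : ℝ} {o : X} (hC : IsCell ρ (closure (ball o ρ)))
    (h : UniformUpTo μ Set.univ) (N : ℕ) :
    IsCell (2 ^ N * ρ) (closure (ball o (2 ^ N * ρ))) := by
  induction N with
  | zero => simpa using hC
  | succ N ih =>
    have := ih.two_mul h ih.mem_closure_ball
    rw [pow_succ', mul_assoc]
    exact this

/-- Folding is an isometry from the cell of size `2 ^ N * ρ` onto the product of the cell of size
`ρ` with the sequences of `N` digits, for the sum of the distance in the cell and `ρ` times the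
distance of the sequences. -/
lemma IsCell.fold_spec {ρ : ℝ} {o : X} (hC : IsCell ρ (closure (ball o ρ)))
    (h : UniformUpTo μ Set.univ) (N : ℕ) :
    (∀ x ∈ closure (ball o (2 ^ N * ρ)), (fold ρ o N x).1 ∈ closure (ball o ρ) ∧
      (∀ j, N ≤ j → (fold ρ o N x).2 j = false) ∧
      ∀ y ∈ closure (ball o (2 ^ N * ρ)), dist x y = dist (fold ρ o N x).1 (fold ρ o N y).1 +
        ρ * digitDist (fun i : ℕ => (i : ℤ)) (fold ρ o N x).2 (fold ρ o N y).2) ∧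
    ∀ z ∈ closure (ball o ρ), ∀ s : ℕ → Bool, (∀ j, N ≤ j → s j = false) →
      ∃ x ∈ closure (ball o (2 ^ N * ρ)), fold ρ o N x = (z, s) := by
  induction N with
  | zero =>
    constructor
    · intro x hx
      refine ⟨by simpa [fold] using hx, by simp [fold], fun y _ => ?_⟩
      simp [fold, digitDist_self]
    · intro z hz s hs
      refine ⟨z, by simpa using hz, ?_⟩
      rw [fold]
      congr 1
      funext j
      exact (hs j (Nat.zero_le j)).symm
  | succ N ih =>
    obtain ⟨ih1, ih2⟩ := ih
    have hCN := hC.two_pow_mul h N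
    have hsucc : (2 : ℝ) ^ (N + 1) * ρ = 2 * (2 ^ N * ρ) := by ring
    obtain ⟨hp1, hp2⟩ := hCN.partner_spec h
    rw [hsucc]
    have hmixed : ∀ x ∈ closure (ball o (2 * (2 ^ N * ρ))), x ∉ closure (ball o (2 ^ N * ρ)) →
        ∀ y ∈ closure (ball o (2 ^ N * ρ)), dist x y =
          dist (fold ρ o (N + 1) x).1 (fold ρ o (N + 1) y).1 +
          ρ * digitDist (fun i : ℕ => (i : ℤ)) (fold ρ o (N + 1) x).2 (fold ρ o (N + 1) y).2 := by
      intro x hx hxC y hyC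
      obtain ⟨h1, h2, -⟩ := hp1 x hx hxC
      obtain ⟨-, hs, hd⟩ := ih1 _ h1
      obtain ⟨-, ht, -⟩ := ih1 y hyC
      rw [fold_succ_of_notMem hxC, fold_succ_of_mem hyC, h2 y hyC, hd y hyC,
        digitDist_update_left (summable_digit_of_eq_false hs ht) (hs N le_rfl) (ht N le_rfl)]
      rw [zpow_natCast]
      ring
    constructor
    · intro x hx
      by_cases hxC : x ∈ closure (ball o (2 ^ N * ρ))
      · obtain ⟨h1, h2, h3⟩ := ih1 x hxC
        refine ⟨by rwa [fold_succ_of_mem hxC], fun j hj => ?_, fun y hy => ?_⟩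
        · rw [fold_succ_of_mem hxC]
          exact h2 j (by omega)
        · by_cases hyC : y ∈ closure (ball o (2 ^ N * ρ))
          · rw [fold_succ_of_mem hxC, fold_succ_of_mem hyC]
            exact h3 y hyC
          · rw [dist_comm, hmixed y hy hyC x hxC, dist_comm, digitDist_comm]
      · obtain ⟨h1, h2, h3⟩ := hp1 x hx hxC
        obtain ⟨h4, h5, h6⟩ := ih1 _ h1
        refine ⟨by rwa [fold_succ_of_notMem hxC], fun j hj => ?_, fun y hy => ?_⟩
        · rw [fold_succ_of_notMem hxC]
          simp only
          rw [Function.update_of_ne (by omega)]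
          exact h5 j (by omega)
        · by_cases hyC : y ∈ closure (ball o (2 ^ N * ρ))
          · exact hmixed x hx hxC y hyC
          · obtain ⟨h7, -, -⟩ := hp1 y hy hyC
            obtain ⟨-, h8, -⟩ := ih1 _ h7
            rw [fold_succ_of_notMem hxC, fold_succ_of_notMem hyC, h3 y hy hyC, h6 _ h7,
              digitDist_update_update _ (h5 N le_rfl) (h8 N le_rfl)]
    · intro z hz s hs
      cases hsN : s N with
      | false =>
        obtain ⟨x, hx, hxz⟩ := ih2 z hz s fun j hj => by
          rcases hj.eq_or_lt with rfl | hj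
          · exact hsN
          · exact hs j hj
        refine ⟨x, closure_mono (ball_subset_ball ?_) hx, by rw [fold_succ_of_mem hx, hxz]⟩
        linarith [hCN.pos]
      | true =>
        obtain ⟨y, hy, hyz⟩ := ih2 z hz (Function.update s N false) fun j hj => by
          rcases hj.eq_or_lt with rfl | hj
          · simp
          · rw [Function.update_of_ne (by omega)]
            exact hs j hj
        obtain ⟨x, hx, hxC, hxy⟩ := hp2 y hy
        refine ⟨x, hx, ?_⟩
        rw [fold_succ_of_notMem hxC, hxy, hyz]
        simp [← hsN]

/-- Folding is an isometry from the whole space onto the product of a cell with the finite binary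
sequences. -/
lemma IsCell.foldAll_spec {ρ : ℝ} {o : X} (hC : IsCell ρ (closure (ball o ρ)))
    (h : UniformUpTo μ Set.univ) :
    (∀ x, (foldAll ρ o x).1 ∈ closure (ball o ρ) ∧
      ∃ N : ℕ, ∀ j, N ≤ j → (foldAll ρ o x).2 j = false) ∧
    (∀ x y, dist x y = dist (foldAll ρ o x).1 (foldAll ρ o y).1 +
      ρ * digitDist (fun i : ℕ => (i : ℤ)) (foldAll ρ o x).2 (foldAll ρ o y).2) ∧
    ∀ z ∈ closure (ball o ρ), ∀ s : BinarySeq, ∃ x, foldAll ρ o x = (z, s.val) := by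
  have hρ := hC.pos
  have hspec := hC.fold_spec h
  refine ⟨fun x => ?_, fun x y => ?_, fun z hz s => ?_⟩
  · obtain ⟨N, hN⟩ := exists_mem_closure_ball_two_pow hρ o x
    rw [foldAll_eq hρ hN]
    exact ⟨((hspec N).1 x hN).1, N, ((hspec N).1 x hN).2.1⟩
  · obtain ⟨n, hn⟩ := exists_mem_closure_ball_two_pow hρ o x
    obtain ⟨m, hm⟩ := exists_mem_closure_ball_two_pow hρ o y
    have hx : x ∈ closure (ball o (2 ^ max n m * ρ)) := by
      refine closure_mono (ball_subset_ball ?_) hn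
      gcongr
      · norm_num
      · exact le_max_left _ _
    have hy : y ∈ closure (ball o (2 ^ max n m * ρ)) := by
      refine closure_mono (ball_subset_ball ?_) hm
      gcongr
      · norm_num
      · exact le_max_right _ _
    rw [foldAll_eq hρ hx, foldAll_eq hρ hy]
    exact ((hspec (max n m)).1 x hx).2.2 y hy
  · obtain ⟨N, hN⟩ := s.eventually_zero
    obtain ⟨x, hx, hxz⟩ := (hspec N).2 z hz s.val hN
    exact ⟨x, by rw [foldAll_eq hρ hx, hxz]⟩

/-- A cell of size `ρ` splits the space as its product with the finite binary sequences. -/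
theorem IsCell.exists_equiv_prod {ρ : ℝ} {o : X} (hC : IsCell ρ (closure (ball o ρ)))
    (h : UniformUpTo μ Set.univ) :
    ∃ e : X ≃ closure (ball o ρ) × BinarySeq, ∀ x y : X,
      dist x y = dist (e x).1 (e y).1 + ρ * dist (e x).2 (e y).2 := by
  obtain ⟨h1, h2, h3⟩ := hC.foldAll_spec h
  set f : X → closure (ball o ρ) × BinarySeq := fun x =>
    (⟨(foldAll ρ o x).1, (h1 x).1⟩, ⟨(foldAll ρ o x).2, (h1 x).2⟩) with hf
  have hdist : ∀ x y, dist x y = dist (f x).1 (f y).1 + ρ * dist (f x).2 (f y).2 := h2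
  have hinj : Function.Injective f := by
    intro x y hxy
    have := hdist x y
    rw [hxy] at this
    simpa using this
  have hsurj : Function.Surjective f := by
    rintro ⟨⟨z, hz⟩, s⟩
    obtain ⟨x, hx⟩ := h3 z hz s
    exact ⟨x, Prod.ext (Subtype.ext (congrArg Prod.fst hx)) (BinarySeq.ext (congrArg Prod.snd hx))⟩
  exact ⟨Equiv.ofBijective f ⟨hinj, hsurj⟩, hdist⟩

end Fold

/-! ### The dyadic space -/

/-- In the dyadic space the digits from the position `k` on determine the distance up to
`2 ^ k`. -/
lemma DyadicSpace.exists_dist_eq_add (s t : DyadicSpace) (k : ℤ) :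
    ∃ R : ℝ, 0 ≤ R ∧ R ≤ 2 ^ k ∧ dist s t = 2 ^ k * digitDist (fun i : ℕ => (i : ℤ))
      (fun j => s.val (k + j)) (fun j => t.val (k + j)) + R := by
  have hsum := s.summable t
  set a : ℤ → ℝ := fun i => (2 : ℝ) ^ i * |digit (s.val i) - digit (t.val i)| with ha
  have hshift : Summable fun i : ℤ => a (k + i) := (Equiv.addLeft k).summable_iff.2 hsum
  have h1 : Summable fun n : ℕ => a (k + n) :=
    hshift.comp_injective (i := fun n : ℕ => (n : ℤ)) Nat.cast_injective
  have h2 : Summable fun n : ℕ => a (k + -((n : ℤ) + 1)) :=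
    hshift.comp_injective (i := fun n : ℕ => -((n : ℤ) + 1)) fun n m hnm => by
      simp only at hnm
      omega
  refine ⟨∑' n : ℕ, a (k + -((n : ℤ) + 1)), tsum_nonneg fun n => by positivity, ?_, ?_⟩
  · have hgeom : HasSum (fun n : ℕ => (2 : ℝ) ^ k * (1 / 2 / 2 ^ n)) (2 ^ k * 1) :=
      (hasSum_geometric_two' 1).mul_left _
    rw [mul_one] at hgeom
    refine hasSum_le (fun n => ?_) h2.hasSum hgeom
    have hle : |digit (s.val (k + -((n : ℤ) + 1))) - digit (t.val (k + -((n : ℤ) + 1)))| ≤ 1 := by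
      cases s.val (k + -((n : ℤ) + 1)) <;> cases t.val (k + -((n : ℤ) + 1)) <;> simp [digit]
    have hpow : (2 : ℝ) ^ (k + -((n : ℤ) + 1)) = 2 ^ k * (1 / 2 / 2 ^ n) := by
      rw [zpow_add₀ two_ne_zero, zpow_neg, zpow_add₀ two_ne_zero, zpow_natCast, zpow_one,
        div_div, one_div, mul_comm (2 : ℝ) (2 ^ n)]
    calc a (k + -((n : ℤ) + 1)) ≤ (2 : ℝ) ^ (k + -((n : ℤ) + 1)) * 1 :=
          mul_le_mul_of_nonneg_left hle (by positivity)
      _ = 2 ^ k * (1 / 2 / 2 ^ n) := by rw [mul_one, hpow]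
  · have h3 := tsum_of_nat_of_neg_add_one (f := fun i : ℤ => a (k + i)) h1 h2
    have h4 : ∑' i : ℤ, a (k + i) = dist s t := (Equiv.addLeft k).tsum_eq a
    rw [← h4, h3, digitDist, ← tsum_mul_left]
    congr 1
    refine tsum_congr fun n => ?_
    rw [ha, ← mul_assoc, ← zpow_add₀ two_ne_zero]

section Dyadic

variable {X : Type*} [MetricSpace X] [ProperSpace X] [MeasurableSpace X] [BorelSpace X]
  {μ : Measure X}

/-- A uniform space with cells of all sizes `2 ^ k * δ` is a scaled copy of the dyadic space. The
digit at position `k` is the last one recorded by folding onto the cell of size `2 ^ k * δ`. -/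
theorem exists_equiv_dyadicSpace (h : UniformUpTo μ Set.univ) {δ : ℝ} {o : X}
    (hC : ∀ k : ℤ, IsCell (2 ^ k * δ) (closure (ball o (2 ^ k * δ)))) :
    ∃ e : DyadicSpace ≃ X, ∀ p q, dist (e p) (e q) = δ * dist p q := by
  have hpos : ∀ k : ℤ, 0 < (2 : ℝ) ^ k * δ := fun k => (hC k).pos
  have hδ : 0 < δ := by simpa using hpos 0
  set v : X → ℤ → Bool := fun x k => (foldAll (2 ^ k * δ) o x).2 0 with hv
  have hdigits : ∀ (x : X) (j : ℕ) (k : ℤ), (foldAll (2 ^ k * δ) o x).2 j = v x (k + j) := by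
    intro x j
    induction j with
    | zero => intro k; simp [hv]
    | succ j ih =>
      intro k
      rw [foldAll_snd_succ (hpos k), ← mul_assoc, ← zpow_one_add₀ two_ne_zero, ih]
      congr 1
      push_cast
      ring
  have hdist : ∀ (k : ℤ) (x y : X), dist x y = dist (foldAll (2 ^ k * δ) o x).1
      (foldAll (2 ^ k * δ) o y).1 + 2 ^ k * δ * digitDist (fun i : ℕ => (i : ℤ))
        (fun j => v x (k + j)) (fun j => v y (k + j)) := by
    intro k x y
    rw [← funext fun j => hdigits x j k, ← funext fun j => hdigits y j k]
    exact ((hC k).foldAll_spec h).2.1 x y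
  set f : X → DyadicSpace := fun x => ⟨v x, by
    obtain ⟨N, hN⟩ := (((hC 0).foldAll_spec h).1 x).2
    refine ⟨N, fun i hi => ?_⟩
    obtain ⟨j, rfl⟩ := Int.eq_ofNat_of_zero_le ((Int.natCast_nonneg N).trans hi)
    have := hN j (by exact_mod_cast hi)
    rwa [hdigits x j 0, zero_add] at this⟩ with hf
  have hclose : ∀ (k : ℤ) (x y : X), |dist x y - δ * dist (f x) (f y)| ≤ 2 ^ k * δ := by
    intro k x y
    obtain ⟨R, hR0, hR, hst⟩ := DyadicSpace.exists_dist_eq_add (f x) (f y) k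
    have h1 := hdist k x y
    have h2 := (hC k).dist_le (((hC k).foldAll_spec h).1 x).1 (((hC k).foldAll_spec h).1 y).1
    have h3 : (0 : ℝ) ≤ dist (foldAll (2 ^ k * δ) o x).1 (foldAll (2 ^ k * δ) o y).1 :=
      dist_nonneg
    have h4 : δ * R ≤ 2 ^ k * δ := by
      rw [mul_comm]
      exact mul_le_mul_of_nonneg_right hR hδ.le
    have h5 : 0 ≤ δ * R := by positivity
    have h6 : dist x y - δ * dist (f x) (f y) =
        dist (foldAll (2 ^ k * δ) o x).1 (foldAll (2 ^ k * δ) o y).1 - δ * R := by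
      rw [h1, hst]
      simp only [hf]
      ring
    rw [h6]
    exact abs_le.2 ⟨by linarith, by linarith⟩
  have hsmall : ∀ ε > 0, ∃ n : ℕ, (2 : ℝ) ^ (-(n : ℤ)) * δ < ε := by
    intro ε hε
    obtain ⟨n, hn⟩ := exists_pow_lt_of_lt_one (div_pos hε hδ) (by norm_num : (1 / 2 : ℝ) < 1)
    refine ⟨n, ?_⟩
    rw [zpow_neg, zpow_natCast, ← lt_div_iff₀ hδ]
    simpa using hn
  have hiso : ∀ x y, dist x y = δ * dist (f x) (f y) := by
    intro x y
    rw [← sub_eq_zero, ← abs_nonpos_iff]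
    refine le_of_forall_gt_imp_ge_of_dense fun ε hε => ?_
    obtain ⟨n, hn⟩ := hsmall ε hε
    exact (hclose _ x y).trans hn.le
  have hinj : Function.Injective f := by
    intro x y hxy
    have := hiso x y
    rw [hxy] at this
    simpa using this
  have hsurj : Function.Surjective f := by
    intro s
    have hex : ∀ n : ℕ, ∃ x, foldAll (2 ^ (-(n : ℤ)) * δ) o x =
        (o, fun j : ℕ => s.val (-(n : ℤ) + j)) := by
      intro n
      obtain ⟨N, hN⟩ := s.eventually_zero
      exact ((hC (-(n : ℤ))).foldAll_spec h).2.2 o (hC _).mem_closure_ball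
        ⟨fun j : ℕ => s.val (-(n : ℤ) + j), N + n, fun j hj => hN _ (by omega)⟩
    choose x hx using hex
    have hnear : ∀ n : ℕ, dist (f (x n)) s ≤ 2 ^ (-(n : ℤ)) := by
      intro n
      obtain ⟨R, -, hR, hst⟩ := DyadicSpace.exists_dist_eq_add (f (x n)) s (-(n : ℤ))
      have h1 : (fun j : ℕ => (f (x n)).val (-(n : ℤ) + j)) =
          fun j : ℕ => s.val (-(n : ℤ) + j) := by
        funext j
        have := hdigits (x n) j (-(n : ℤ))
        rw [hx n] at this
        exact this.symm
      rw [hst, h1, digitDist_self, mul_zero, zero_add]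
      exact hR
    have hcauchy : CauchySeq x := by
      refine cauchySeq_of_le_geometric (1 / 2) (2 * δ) (by norm_num) fun n => ?_
      have h1 := hnear n
      have h2 := hnear (n + 1)
      have h3 := dist_triangle_right (f (x n)) (f (x (n + 1))) s
      have h4 : (2 : ℝ) ^ (-((n + 1 : ℕ) : ℤ)) ≤ 2 ^ (-(n : ℤ)) :=
        zpow_le_zpow_right₀ (by norm_num) (by push_cast; linarith)
      rw [hiso]
      calc δ * dist (f (x n)) (f (x (n + 1))) ≤ δ * (2 * 2 ^ (-(n : ℤ))) := by
            refine mul_le_mul_of_nonneg_left ?_ hδ.le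
            linarith
        _ = 2 * δ * (1 / 2) ^ n := by
            rw [zpow_neg, zpow_natCast, one_div, inv_pow]
            ring
    obtain ⟨y, hy⟩ := cauchySeq_tendsto_of_complete hcauchy
    refine ⟨y, eq_of_forall_dist_le fun ε hε => ?_⟩
    obtain ⟨n, hn1, hn2⟩ : ∃ n : ℕ, (2 : ℝ) ^ (-(n : ℤ)) * δ < ε * δ / 2 ∧
        dist (x n) y < ε * δ / 2 := by
      obtain ⟨m, hm⟩ := hsmall (ε * δ / 2) (by positivity)
      obtain ⟨m', hm'⟩ := Metric.tendsto_atTop.1 hy (ε * δ / 2) (by positivity)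
      refine ⟨max m m', lt_of_le_of_lt ?_ hm, hm' _ (le_max_right _ _)⟩
      refine mul_le_mul_of_nonneg_right (zpow_le_zpow_right₀ (by norm_num) ?_) hδ.le
      have := le_max_left m m'
      omega
    rw [hiso] at hn2
    have h1 := dist_triangle_left (f y) s (f (x n))
    have h2 := hnear n
    nlinarith
  refine ⟨(Equiv.ofBijective f ⟨hinj, hsurj⟩).symm, fun p q => ?_⟩
  rw [hiso]
  congr 2
  · exact (Equiv.ofBijective f ⟨hinj, hsurj⟩).apply_symm_apply p
  · exact (Equiv.ofBijective f ⟨hinj, hsurj⟩).apply_symm_apply q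

end Dyadic

/-! ### Besicovitch pairs in disconnected spaces -/

section Disconnected

variable {X : Type*} [MetricSpace X] [ProperSpace X]

/-- A bounded open and closed set contains one end of a Besicovitch pair, namely a point as close
as possible to the complement. -/
lemma exists_isBesicovitchPair_of_isClopen {W : Set X} (hW : IsClopen W)
    (hb : Bornology.IsBounded W) (hne : W.Nonempty) (hne' : Wᶜ.Nonempty) :
    ∃ a ∈ W, ∃ b, b ∉ W ∧ IsBesicovitchPair a b ∧
      ∀ x ∈ W, ∀ y, y ∉ W → dist a b ≤ dist x y := by
  have hcpt : IsCompact W := Metric.isCompact_of_isClosed_isBounded hW.1 hb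
  obtain ⟨a, ha, hmin⟩ := hcpt.exists_isMinOn hne (continuous_infDist_pt Wᶜ).continuousOn
  obtain ⟨b, hb, hab⟩ := hW.2.isClosed_compl.exists_infDist_eq_dist hne' a
  have hle : ∀ x ∈ W, ∀ y, y ∉ W → dist a b ≤ dist x y := by
    intro x hx y hy
    rw [← hab]
    exact (hmin hx : infDist a Wᶜ ≤ infDist x Wᶜ).trans (infDist_le_dist_of_mem hy)
  refine ⟨a, ha, b, hb, ⟨fun hab' => hb (hab' ▸ ha), fun x hx y hy => ?_⟩, hle⟩
  rw [mem_ball'] at hx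
  rw [mem_ball] at hy
  have hxW : x ∈ W := by
    by_contra hxW
    exact absurd (hle a ha x hxW) (not_le.2 hx)
  have hyW : y ∉ W := fun hyW => absurd (hle y hyW b hb) (not_le.2 hy)
  exact hle x hxW y hyW

variable [MeasurableSpace X] [BorelSpace X] {μ : Measure X}

/-- A disconnected uniform space has bounded open and closed sets. Otherwise, consider a point `w`
of an open and closed set `Q` that is closest to a point `x` outside `Q`: the complement of `Q`
reaches beyond `w`, but a ball about `w` uses up the measure of a shell about `x`. -/
lemma exists_isClopen_isBounded (h : UniformUpTo μ Set.univ) (hX : ¬ PreconnectedSpace X) :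
    ∃ W : Set X, IsClopen W ∧ Bornology.IsBounded W ∧ W.Nonempty := by
  by_contra hnot
  have hunb : ∀ W : Set X, IsClopen W → Bornology.IsBounded W → W = ∅ := fun W hW hb => by
    by_contra hne
    exact hnot ⟨W, hW, hb, Set.nonempty_iff_ne_empty.2 hne⟩
  rw [preconnectedSpace_iff_clopen] at hX
  push Not at hX
  obtain ⟨Q, hQ, hQne, hQuniv⟩ := hX
  obtain ⟨x, hx⟩ := (Set.ne_univ_iff_exists_notMem Q).1 hQuniv
  obtain ⟨w, hw, hxw⟩ := hQ.1.exists_infDist_eq_dist hQne x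
  set T := dist x w with hT
  have hmin : ∀ z ∈ Q, T ≤ dist x z := fun z hz => hxw ▸ infDist_le_dist_of_mem hz
  have hT0 : 0 < T := dist_pos.2 fun heq => hx (heq ▸ hw)
  obtain ⟨k, hk, hball⟩ := Metric.isOpen_iff.1 hQ.2 w hw
  have hS : μ (closedBall x (T + k) \ ball x T) = ENNReal.ofReal k := by
    rw [h.measure_closed_shell x hT0 (by linarith) (Set.mem_univ _), add_sub_cancel_left]
  have hempty := h.eq_empty_of_measure_le (U := ball w k)
    (V := Qᶜ ∩ (ball x (T + k) \ closedBall x T)) (S := closedBall x (T + k) \ ball x T)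
    (hQ.1.isOpen_compl.inter (isOpen_ball.sdiff isClosed_closedBall))
    (Set.disjoint_of_subset hball Set.inter_subset_left disjoint_compl_right)
    (fun z hz => by
      refine ⟨?_, ?_⟩
      · rw [mem_ball'] at hz
        rw [mem_closedBall']
        have := dist_triangle x w z
        linarith
      · rw [mem_ball', not_lt]
        exact hmin z (hball hz))
    (fun z hz => ⟨ball_subset_closedBall hz.2.1, fun hz' => hz.2.2 (ball_subset_closedBall hz')⟩)
    (by rw [hS, h.measure_ball w k hk (Set.mem_univ _)])
    (by
      rw [hS]
      exact ENNReal.ofReal_ne_top)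
  have hcont : Continuous fun z => dist x z := continuous_const.dist continuous_id
  have hW : IsClopen (Qᶜ ∩ ball x (T + k)) := by
    refine ⟨?_, hQ.1.isOpen_compl.inter isOpen_ball⟩
    have heq : Qᶜ ∩ ball x (T + k) = Qᶜ ∩ closedBall x T := by
      ext z
      constructor
      · rintro ⟨hz1, hz2⟩
        refine ⟨hz1, by_contra fun hz3 => ?_⟩
        have : z ∈ Qᶜ ∩ (ball x (T + k) \ closedBall x T) := ⟨hz1, hz2, hz3⟩
        rw [hempty] at this
        exact this
      · rintro ⟨hz1, hz2⟩
        exact ⟨hz1, closedBall_subset_ball (by linarith) hz2⟩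
    rw [heq]
    exact hQ.2.isClosed_compl.inter isClosed_closedBall
  have hxW : x ∈ Qᶜ ∩ ball x (T + k) := ⟨hx, mem_ball_self (by linarith)⟩
  rw [hunb _ hW (isBounded_ball.subset Set.inter_subset_right)] at hxW
  exact hxW

lemma exists_isBesicovitchPair (h : UniformUpTo μ Set.univ) (hX : ¬ PreconnectedSpace X) :
    ∃ a b : X, IsBesicovitchPair a b := by
  obtain ⟨W, hW, hb, hne⟩ := exists_isClopen_isBounded h hX
  obtain ⟨x, hx⟩ := hne
  have hne' : Wᶜ.Nonempty := by
    obtain ⟨R, hR⟩ := hb.subset_closedBall x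
    obtain ⟨y, hy, -⟩ := h.exists_dist_mem_Ioo x (abs_nonneg R) (lt_add_one _) (Set.mem_univ _)
    refine ⟨y, fun hyW => ?_⟩
    have := mem_closedBall'.1 (hR hyW)
    have := le_abs_self R
    linarith
  obtain ⟨a, -, b, -, hab, -⟩ := exists_isBesicovitchPair_of_isClopen hW hb ⟨x, hx⟩ hne'
  exact ⟨a, b, hab⟩

/-- If a cell contains the centre of a smaller cell, then its size is the size of the smaller cell
multiplied by a power of two, and it consists of two cells of half its size. -/
lemma IsCell.half_of_lt (h : UniformUpTo μ Set.univ) {ε ρ : ℝ} {a o : X}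
    (hε : IsCell ε (closure (ball a ε))) (hρ : IsCell ρ (closure (ball a ρ))) (hlt : ε < ρ)
    (ho : o ∈ closure (ball a ρ)) : IsCell (ρ / 2) (closure (ball o (ρ / 2))) := by
  obtain ⟨k, hk1, hk2⟩ : ∃ k : ℕ, 2 ^ k * ε < ρ ∧ ρ ≤ 2 ^ (k + 1) * ε := by
    have hex : ∃ n : ℕ, ρ ≤ 2 ^ n * ε := by
      obtain ⟨n, hn⟩ := pow_unbounded_of_one_lt (ρ / ε) (one_lt_two (α := ℝ))
      exact ⟨n, ((div_lt_iff₀ hε.pos).1 hn).le⟩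
    classical
    have hspec := Nat.find_spec hex
    have hmin := fun m => Nat.find_min (H := hex) (m := m)
    cases hn : Nat.find hex with
    | zero =>
      rw [hn, pow_zero, one_mul] at hspec
      linarith
    | succ n =>
      rw [hn] at hspec hmin
      exact ⟨n, not_le.1 (hmin n (Nat.lt_succ_self n)), hspec⟩
  have hC := hε.two_pow_mul h k
  set r := 2 ^ k * ε with hr
  have hr2 : ρ ≤ 2 * r := by
    rw [pow_succ] at hk2
    linarith
  obtain ⟨C', hC', hdisj, x, hx, y, hy, hxy⟩ := hC.exists_neighbour h
  have hU := hC.union hC' hdisj h hx hy hxy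
  have haC := hC.mem_closure_ball
  obtain ⟨b, hb, hab⟩ := hC.forall_exists_partner hC' hdisj h hx hy hxy a haC
  have hsub1 : closure (ball a r) ⊆ closure (ball a ρ) := closure_mono (ball_subset_ball hk1.le)
  have hbρ : b ∈ closure (ball a ρ) := subset_closure (by rw [mem_ball', hab]; exact hk1)
  have hsub2 : C' ⊆ closure (ball a ρ) :=
    (hC'.subset_closedBall b hb).trans ((closedBall_subset_ball hk1).trans (hρ.ball_subset b hbρ))
  have heq : ρ = 2 * r := by
    refine le_antisymm hr2 ?_
    have h1 : μ (closure (ball a r) ∪ C') ≤ μ (closure (ball a ρ)) :=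
      measure_mono (Set.union_subset hsub1 hsub2)
    rw [hU.measure_eq h, hρ.measure_eq h] at h1
    exact (ENNReal.ofReal_le_ofReal_iff hρ.pos.le).1 h1
  have hU' := hU.eq_closure_ball h (Or.inl haC)
  rw [← heq] at hU'
  rw [← hU'] at ho
  have hρr : ρ / 2 = r := by linarith
  rw [hρr]
  rcases ho with ho | ho
  · rw [← hC.eq_closure_ball h ho]
    exact hC
  · rw [← hC'.eq_closure_ball h ho]
    exact hC'

/-- A disconnected cell consists of two cells of half its size. -/
lemma IsCell.half (h : UniformUpTo μ Set.univ) {ρ : ℝ} {o : X}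
    (hC : IsCell ρ (closure (ball o ρ))) (hconn : ¬ IsConnected (closure (ball o ρ))) :
    IsCell (ρ / 2) (closure (ball o (ρ / 2))) := by
  set C := closure (ball o ρ) with hCdef
  have hpre : ¬ IsPreconnected C := fun hp => hconn ⟨hC.nonempty, hp⟩
  rw [isPreconnected_iff_subset_of_disjoint] at hpre
  push Not at hpre
  obtain ⟨u, v, hu, hv, hsub, huv, hu', hv'⟩ := hpre
  have hWu : C ∩ u = C \ v := by
    ext z
    constructor
    · rintro ⟨h1, h2⟩
      refine ⟨h1, fun h3 => ?_⟩
      have : z ∈ C ∩ (u ∩ v) := ⟨h1, h2, h3⟩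
      rw [huv] at this
      exact this
    · rintro ⟨h1, h2⟩
      exact ⟨h1, (hsub h1).resolve_right h2⟩
  have hW : IsClopen (C ∩ u) :=
    ⟨by rw [hWu]; exact hC.isClosed.sdiff hv, hC.isOpen.inter hu⟩
  obtain ⟨x, hxC, hxv⟩ := Set.not_subset.1 hv'
  obtain ⟨y, hyC, hyu⟩ := Set.not_subset.1 hu'
  have hxW : x ∈ C ∩ u := ⟨hxC, (hsub hxC).resolve_right hxv⟩
  have hyv : y ∈ v := (hsub hyC).resolve_left hyu
  obtain ⟨a, ha, b, hb, hab, hmin⟩ := exists_isBesicovitchPair_of_isClopen hW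
    (hC.isBounded.subset Set.inter_subset_left) ⟨x, hxW⟩ ⟨y, fun hy => hyu hy.2⟩
  have hlt : dist a b < ρ := by
    -- The ball of radius `ρ` about `x` is dense in the cell, so it meets the other part.
    have hyx : y ∈ closure (ball x ρ) := hC.eq_closure_ball h hxC ▸ hyC
    obtain ⟨z, hz1, hz2⟩ := mem_closure_iff.1 hyx (C ∩ v) (hC.isOpen.inter hv) ⟨hyC, hyv⟩
    refine (hmin x hxW z fun hz3 => ?_).trans_lt (mem_ball'.1 hz2)
    rw [hWu] at hz3
    exact hz3.2 hz1.2
  have haC := hC.eq_closure_ball h ha.1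
  have hoC : o ∈ C := hC.mem_closure_ball
  rw [haC] at hC hoC
  exact IsCell.half_of_lt h (hab.isCell h) hC hlt hoC

/-- The alternative for disconnected spaces: repeated halving of a cell ends with a connected cell
or goes on forever. -/
lemma exists_connected_cell_or_forall_cell (h : UniformUpTo μ Set.univ)
    (hX : ¬ PreconnectedSpace X) :
    (∃ (ρ : ℝ) (o : X), IsCell ρ (closure (ball o ρ)) ∧ IsConnected (closure (ball o ρ))) ∨
    ∃ (δ : ℝ) (o : X), ∀ k : ℤ, IsCell (2 ^ k * δ) (closure (ball o (2 ^ k * δ))) := by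
  by_cases hex : ∃ (ρ : ℝ) (o : X),
      IsCell ρ (closure (ball o ρ)) ∧ IsConnected (closure (ball o ρ))
  · exact Or.inl hex
  · right
    obtain ⟨a, b, hab⟩ := exists_isBesicovitchPair h hX
    have hC := hab.isCell h
    refine ⟨dist a b, a, fun k => ?_⟩
    obtain ⟨n, rfl | rfl⟩ := k.eq_nat_or_neg
    · rw [zpow_natCast]
      exact hC.two_pow_mul h n
    · induction n with
      | zero => simpa using hC
      | succ n ih =>
        have h1 := ih.half h fun hconn => hex ⟨_, _, ih, hconn⟩
        have h2 : (2 : ℝ) ^ (-((n + 1 : ℕ) : ℤ)) * dist a b = 2 ^ (-(n : ℤ)) * dist a b / 2 := by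
          rw [zpow_neg, zpow_neg, zpow_natCast, zpow_natCast, pow_succ, mul_inv]
          ring
        rw [h2]
        exact h1

end Disconnected

/-! ### Identification of the measures -/

section Uniqueness

open Filter Topology

variable {X : Type*} [MetricSpace X] [MeasurableSpace X] {μ ν : Measure X}

lemma isLocallyFiniteMeasure_of_measure_ball {r : ℝ} (hr : 0 < r)
    (hμ : ∀ x, μ (ball x r) = ENNReal.ofReal r) : IsLocallyFiniteMeasure μ :=
  ⟨fun x => ⟨ball x r, ball_mem_nhds x hr, by rw [hμ]; exact ENNReal.ofReal_lt_top⟩⟩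

variable [BorelSpace X] [ProperSpace X]

/-- The measure of an open set `U` is the `μ`-integral over `U` of the limit, as `r` tends to `0`,
of the quotients `ν (U ∩ ball x r) / r`. By Fatou's lemma and Tonelli's theorem, it is at most the
limit of the `ν`-integrals over `U` of `μ (ball y r) / r = 1`. -/
lemma measure_le_of_measure_ball {R : ℝ} (hR : 0 < R)
    (hμ : ∀ (x : X) (r : ℝ), 0 < r → r < R → μ (ball x r) = ENNReal.ofReal r)
    (hν : ∀ (x : X) (r : ℝ), 0 < r → r < R → ν (ball x r) = ENNReal.ofReal r)
    {U : Set X} (hU : IsOpen U) : μ U ≤ ν U := by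
  have := isLocallyFiniteMeasure_of_measure_ball (half_pos hR) fun x =>
    hμ x (R / 2) (half_pos hR) (half_lt_self hR)
  have := isLocallyFiniteMeasure_of_measure_ball (half_pos hR) fun x =>
    hν x (R / 2) (half_pos hR) (half_lt_self hR)
  obtain ⟨r, -, hr, hlim⟩ := exists_seq_strictAnti_tendsto' hR
  set E : ℕ → Set (X × X) := fun n => {p | p.2 ∈ U ∧ dist p.1 p.2 < r n} with hE
  have hEm : ∀ n, MeasurableSet (E n) := fun n =>
    ((hU.preimage continuous_snd).inter (isOpen_lt continuous_dist continuous_const)).measurableSet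
  have hsection : ∀ n x, Prod.mk x ⁻¹' E n = U ∩ ball x (r n) := by
    intro n x
    ext y
    rw [Set.mem_inter_iff, mem_ball']
    rfl
  have hmeas : ∀ n, Measurable fun x => ν (U ∩ ball x (r n)) := by
    intro n
    have := measurable_measure_prodMk_left (ν := ν) (hEm n)
    simpa only [hsection] using this
  have hint : ∀ n, ∫⁻ x in U, ν (U ∩ ball x (r n)) ∂μ ≤ ENNReal.ofReal (r n) * ν U := by
    intro n
    calc ∫⁻ x in U, ν (U ∩ ball x (r n)) ∂μ = ((μ.restrict U).prod ν) (E n) := by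
          rw [Measure.prod_apply (hEm n)]
          simp only [hsection]
      _ = ∫⁻ y, (μ.restrict U) ((fun x => (x, y)) ⁻¹' E n) ∂ν := Measure.prod_apply_symm (hEm n)
      _ ≤ ∫⁻ y, U.indicator (fun _ => ENNReal.ofReal (r n)) y ∂ν := by
          refine lintegral_mono fun y => ?_
          by_cases hy : y ∈ U
          · rw [Set.indicator_of_mem hy, ← hμ y (r n) (hr n).1 (hr n).2]
            refine (Measure.restrict_apply_le _ _).trans (measure_mono fun x hx => ?_)
            exact hx.2
          · rw [Set.indicator_of_notMem hy]
            have : (fun x => (x, y)) ⁻¹' E n = ∅ := by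
              ext x
              exact ⟨fun hx => hy hx.1, fun hx => hx.elim⟩
            rw [this, measure_empty]
      _ = ENNReal.ofReal (r n) * ν U := by
          rw [lintegral_indicator_const hU.measurableSet]
  calc μ U = ∫⁻ x in U, 1 ∂μ := by simp
    _ ≤ ∫⁻ x in U, liminf (fun n => ν (U ∩ ball x (r n)) / ENNReal.ofReal (r n)) atTop ∂μ := by
        refine setLIntegral_mono' hU.measurableSet fun x hx => ?_
        obtain ⟨ε, hε, hball⟩ := Metric.isOpen_iff.1 hU x hx
        refine le_liminf_of_le (by isBoundedDefault) ?_
        filter_upwards [hlim.eventually (gt_mem_nhds hε)] with n hn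
        rw [Set.inter_eq_right.2 ((ball_subset_ball hn.le).trans hball),
          hν x (r n) (hr n).1 (hr n).2, ENNReal.div_self]
        · simpa using (hr n).1
        · exact ENNReal.ofReal_ne_top
    _ ≤ liminf (fun n => ∫⁻ x in U, ν (U ∩ ball x (r n)) / ENNReal.ofReal (r n) ∂μ) atTop :=
        lintegral_liminf_le fun n => (hmeas n).div_const _
    _ ≤ liminf (fun _ : ℕ => ν U) atTop := by
        refine liminf_le_liminf (Eventually.of_forall fun n => ?_)
        simp only [div_eq_mul_inv]
        rw [lintegral_mul_const _ (hmeas n), ← div_eq_mul_inv]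
        refine ENNReal.div_le_of_le_mul ?_
        rw [mul_comm]
        exact hint n
    _ = ν U := liminf_const _

/-- Christensen's theorem: a measure is determined by the balls of small radius, if their measure
does not depend on the centre. -/
theorem measure_eq_of_measure_ball {R : ℝ} (hR : 0 < R)
    (hμ : ∀ (x : X) (r : ℝ), 0 < r → r < R → μ (ball x r) = ENNReal.ofReal r)
    (hν : ∀ (x : X) (r : ℝ), 0 < r → r < R → ν (ball x r) = ENNReal.ofReal r) : μ = ν := by
  have := isLocallyFiniteMeasure_of_measure_ball (half_pos hR) fun x =>
    hμ x (R / 2) (half_pos hR) (half_lt_self hR)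
  have := isLocallyFiniteMeasure_of_measure_ball (half_pos hR) fun x =>
    hν x (R / 2) (half_pos hR) (half_lt_self hR)
  exact Measure.OuterRegular.ext_isOpen fun U hU =>
    le_antisymm (measure_le_of_measure_ball hR hμ hν hU) (measure_le_of_measure_ball hR hν hμ hU)

end Uniqueness

section Scaling

variable {X Y : Type*} [MetricSpace X] [MetricSpace Y] {c : ℝ} {e : Y ≃ X}

lemma continuous_of_dist_eq_mul (he : ∀ p q, dist (e p) (e q) = c * dist p q) :
    Continuous e :=
  (LipschitzWith.of_dist_le_mul (K := c.toNNReal) fun p q => by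
    rw [he]
    exact mul_le_mul_of_nonneg_right (Real.le_coe_toNNReal c) dist_nonneg).continuous

lemma dist_symm_eq_inv_mul (hc : 0 < c) (he : ∀ p q, dist (e p) (e q) = c * dist p q) (x y : X) :
    dist (e.symm x) (e.symm y) = c⁻¹ * dist x y := by
  have := he (e.symm x) (e.symm y)
  rw [e.apply_symm_apply, e.apply_symm_apply] at this
  rw [this, inv_mul_cancel_left₀ hc.ne']

variable [MeasurableSpace X] [BorelSpace X] [MeasurableSpace Y] [BorelSpace Y]

/-- The Hausdorff measure scales like the metric. -/
lemma hausdorffMeasure_eq_smul_map (hc : 0 < c) (he : ∀ p q, dist (e p) (e q) = c * dist p q) :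
    (μH[1] : Measure X) = ENNReal.ofReal c • (μH[1] : Measure Y).map e := by
  have hL : LipschitzWith c.toNNReal e := LipschitzWith.of_dist_le_mul fun p q => by
    rw [he, Real.coe_toNNReal c hc.le]
  have hL' : LipschitzWith c.toNNReal⁻¹ e.symm := LipschitzWith.of_dist_le_mul fun p q => by
    rw [dist_symm_eq_inv_mul hc he, NNReal.coe_inv, Real.coe_toNNReal c hc.le]
  have hc' : c.toNNReal ≠ 0 := by simpa using hc
  ext A hA
  rw [Measure.smul_apply, Measure.map_apply (continuous_of_dist_eq_mul he).measurable hA,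
    smul_eq_mul]
  have h1 := hL.hausdorffMeasure_image_le zero_le_one (e ⁻¹' A)
  have h2 := hL'.hausdorffMeasure_image_le zero_le_one A
  rw [e.image_preimage, ENNReal.rpow_one] at h1
  rw [e.symm.image_eq_preimage_symm, e.symm_symm, ENNReal.rpow_one, ENNReal.coe_inv hc'] at h2
  refine le_antisymm h1 ?_
  have hc0 : ENNReal.ofReal c ≠ 0 := by simpa using hc
  calc ENNReal.ofReal c * μH[1] (e ⁻¹' A)
      ≤ ENNReal.ofReal c * ((ENNReal.ofReal c)⁻¹ * μH[1] A) := by gcongr; exact h2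
    _ = μH[1] A := by
        rw [← mul_assoc, ENNReal.mul_inv_cancel hc0 ENNReal.ofReal_ne_top, one_mul]

/-- A 1-uniform measure on a scaled copy of `Y` is the scaled copy of any measure on `Y` for which
small balls have the right measure. -/
lemma eq_smul_map_of_measure_ball [ProperSpace X] {μ : Measure X} {ν : Measure Y}
    (h : UniformUpTo μ Set.univ) (hc : 0 < c) (he : ∀ p q, dist (e p) (e q) = c * dist p q)
    {R : ℝ} (hR : 0 < R)
    (hν : ∀ (p : Y) (r : ℝ), 0 < r → r < R → ν (ball p r) = ENNReal.ofReal r) :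
    μ = ENNReal.ofReal c • ν.map e := by
  refine measure_eq_of_measure_ball (mul_pos hc hR)
    (fun x r hr _ => h.measure_ball x r hr (Set.mem_univ _)) fun x r hr hrR => ?_
  have hpre : e ⁻¹' ball x r = ball (e.symm x) (r / c) := by
    ext p
    rw [Set.mem_preimage, mem_ball, mem_ball, lt_div_iff₀ hc, mul_comm, ← he, e.apply_symm_apply]
  rw [Measure.smul_apply, Measure.map_apply (continuous_of_dist_eq_mul he).measurable
    measurableSet_ball, hpre, hν _ _ (div_pos hr hc) ((div_lt_iff₀ hc).2 (by rwa [mul_comm])),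
    smul_eq_mul, ← ENNReal.ofReal_mul hc.le, mul_div_cancel₀ _ hc.ne']

end Scaling

lemma lineMeasure_ball (x r : ℝ) : lineMeasure (ball x r) = ENNReal.ofReal r := by
  rw [lineMeasure, Measure.smul_apply, hausdorffMeasure_real, Real.volume_ball, smul_eq_mul,
    ENNReal.ofReal_mul zero_le_two, ENNReal.ofReal_ofNat, ← mul_assoc,
    ENNReal.inv_mul_cancel two_ne_zero ENNReal.ofNat_ne_top, one_mul]

/-- Distinct finite binary sequences are at distance at least `1`. -/
lemma BinarySeq.one_le_dist {s t : BinarySeq} (hst : s ≠ t) : 1 ≤ dist s t := by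
  obtain ⟨i, hi⟩ : ∃ i, s.val i ≠ t.val i := by
    by_contra hnot
    push Not at hnot
    exact hst (BinarySeq.ext (funext hnot))
  have h1 := (s.summable t).le_tsum i fun j _ => digitDist_term_nonneg (fun i : ℕ => (i : ℤ)) _ _ j
  have h2 : |digit (s.val i) - digit (t.val i)| = 1 := by
    revert hi
    cases s.val i <;> cases t.val i <;> simp [digit]
  rw [h2, mul_one, zpow_natCast] at h1
  exact (one_le_pow₀ one_le_two).trans h1

/-- A small ball of `𝒯` is isometric to an interval. -/
lemma circleMeasure_ball (p : CircleSpace) {r : ℝ} (hr : 0 < r) (hr' : r < 1 / 2) :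
    circleMeasure (ball p r) = ENNReal.ofReal r := by
  set g : ball (0 : ℝ) r → CircleSpace := fun u => ⟨p.pt + ((u : ℝ) : AddCircle (2 : ℝ)), p.seq⟩
    with hg
  have hgiso : Isometry g := by
    refine Isometry.of_dist_eq fun u v => ?_
    have hu := mem_ball_zero_iff.1 u.2
    have hv := mem_ball_zero_iff.1 v.2
    rw [Real.norm_eq_abs, abs_lt] at hu hv
    rw [CircleSpace.dist_def, dist_self, add_zero, dist_add_left, dist_eq_norm,
      ← AddCircle.coe_sub, AddCircle.norm_coe_of_abs_le_one (abs_le.2 ⟨by linarith, by linarith⟩)]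
    rfl
  have himage : g '' Set.univ = ball p r := by
    rw [Set.image_univ]
    ext q
    rw [mem_ball, CircleSpace.dist_def]
    constructor
    · rintro ⟨u, rfl⟩
      have hu := mem_ball_zero_iff.1 u.2
      rw [Real.norm_eq_abs] at hu
      simp only [hg, dist_self, add_zero]
      rw [dist_eq_norm, add_sub_cancel_left, AddCircle.norm_coe_of_abs_le_one (by linarith)]
      exact hu
    · intro hq
      have h1 : (0 : ℝ) ≤ dist q.pt p.pt := dist_nonneg
      have hseq : q.seq = p.seq := by
        by_contra hne
        linarith [BinarySeq.one_le_dist hne]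
      rw [hseq, dist_self, add_zero, dist_eq_norm] at hq
      obtain ⟨u, hu, hu'⟩ := AddCircle.exists_coe_eq_norm (q.pt - p.pt)
      refine ⟨⟨u, ?_⟩, CircleSpace.ext ?_ hseq.symm⟩
      · rw [mem_ball_zero_iff, Real.norm_eq_abs, ← hu']
        exact hq
      · simp only [hg, hu]
        abel
  have h1 := hgiso.hausdorffMeasure_image (Or.inl zero_le_one) (d := 1) Set.univ
  have h2 := (isometry_subtype_coe (s := ball (0 : ℝ) r)).hausdorffMeasure_image
    (Or.inl zero_le_one) (d := 1) Set.univ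
  rw [Set.image_univ, Subtype.range_coe] at h2
  rw [circleMeasure, Measure.smul_apply, ← himage, h1, ← h2, ← lineMeasure_ball 0 r, lineMeasure,
    Measure.smul_apply]

section HausdorffMeasure

open Filter Topology

variable {X : Type*} [MetricSpace X] [MeasurableSpace X] [BorelSpace X] {μ : Measure X}

/-- A set of diameter `d` lies in a closed ball of radius `d`, whose measure is `d`. -/
lemma UniformUpTo.le_hausdorffMeasure (h : UniformUpTo μ Set.univ) : μ ≤ μH[1] := by
  refine Measure.le_hausdorffMeasure 1 μ 1 one_pos fun s hs => ?_
  rw [ENNReal.rpow_one]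
  rcases s.eq_empty_or_nonempty with rfl | ⟨x, hx⟩
  · simp
  have hne : ediam s ≠ ∞ := (hs.trans_lt ENNReal.one_lt_top).ne
  calc μ s ≤ μ (closedBall x (diam s)) := measure_mono fun y hy =>
        mem_closedBall.2 (dist_le_diam_of_mem' hne hy hx)
    _ = ENNReal.ofReal (diam s) := h.measure_closedBall x diam_nonneg (Set.mem_univ _)
    _ = ediam s := ENNReal.ofReal_toReal hne

variable [ProperSpace X]

/-- A cell is covered by `2 ^ n` sets whose diameter is `2 ^ n` times smaller. -/
lemma hausdorffMeasure_cell_le (h : UniformUpTo μ Set.univ) {δ : ℝ} {o : X}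
    (hC : ∀ k : ℤ, IsCell (2 ^ k * δ) (closure (ball o (2 ^ k * δ)))) (N : ℕ) :
    μH[1] (closure (ball o (2 ^ N * δ))) ≤ ENNReal.ofReal (2 ^ N * δ) := by
  have hδ : 0 < δ := by simpa using (hC 0).pos
  have hscale : ∀ n : ℕ, (2 : ℝ) ^ (N + n) * (2 ^ (-(n : ℤ)) * δ) = 2 ^ N * δ := by
    intro n
    rw [pow_add, zpow_neg, zpow_natCast]
    field_simp
  set t : ∀ n : ℕ, (Fin (N + n) → Bool) → Set X := fun n s =>
    {x | x ∈ closure (ball o (2 ^ N * δ)) ∧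
      ∀ j : Fin (N + n), (fold (2 ^ (-(n : ℤ)) * δ) o (N + n) x).2 j = s j} with ht
  have hdiam : ∀ n s, ediam (t n s) ≤ ENNReal.ofReal (2 ^ (-(n : ℤ)) * δ) := by
    intro n s
    refine Metric.ediam_le_of_forall_dist_le ?_
    rintro x ⟨hx, hx'⟩ y ⟨hy, hy'⟩
    have hspec := ((hC (-(n : ℤ))).fold_spec h (N + n)).1
    rw [hscale] at hspec
    obtain ⟨h1, h2, h3⟩ := hspec x hx
    obtain ⟨h4, h5, -⟩ := hspec y hy
    have h6 : (fold (2 ^ (-(n : ℤ)) * δ) o (N + n) x).2 =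
        (fold (2 ^ (-(n : ℤ)) * δ) o (N + n) y).2 := by
      funext j
      by_cases hj : j < N + n
      · exact (hx' ⟨j, hj⟩).trans (hy' ⟨j, hj⟩).symm
      · rw [h2 j (not_lt.1 hj), h5 j (not_lt.1 hj)]
    rw [h3 y hy, h6, digitDist_self, mul_zero, add_zero]
    exact (hC (-(n : ℤ))).dist_le h1 h4
  have hlim : Tendsto (fun n : ℕ => ENNReal.ofReal (2 ^ (-(n : ℤ)) * δ)) atTop (𝓝 0) := by
    rw [← ENNReal.ofReal_zero]
    refine ENNReal.tendsto_ofReal ?_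
    have := (tendsto_pow_atTop_nhds_zero_of_lt_one (r := (1 / 2 : ℝ)) (by norm_num)
      (by norm_num)).mul_const δ
    rw [zero_mul] at this
    refine this.congr fun n => ?_
    rw [zpow_neg, zpow_natCast, one_div, inv_pow]
  refine (Measure.hausdorffMeasure_le_liminf_sum (l := atTop) 1 _ _ hlim t
    (Eventually.of_forall hdiam) (Eventually.of_forall fun n x hx =>
      Set.mem_iUnion.2 ⟨fun j => (fold (2 ^ (-(n : ℤ)) * δ) o (N + n) x).2 j,
        hx, fun j => rfl⟩)).trans ?_
  refine (liminf_le_liminf (v := fun _ : ℕ => ENNReal.ofReal (2 ^ N * δ))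
    (Eventually.of_forall fun n => ?_)).trans (liminf_const _).le
  calc ∑ s, ediam (t n s) ^ (1 : ℝ)
      ≤ ∑ _s : Fin (N + n) → Bool, ENNReal.ofReal (2 ^ (-(n : ℤ)) * δ) := by
        refine Finset.sum_le_sum fun s _ => ?_
        rw [ENNReal.rpow_one]
        exact hdiam n s
    _ = ENNReal.ofReal (2 ^ N * δ) := by
        have hsplit : ENNReal.ofReal (2 ^ N * δ) =
            ENNReal.ofReal (2 ^ (N + n)) * ENNReal.ofReal (2 ^ (-(n : ℤ)) * δ) := by
          rw [← ENNReal.ofReal_mul (by positivity), hscale]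
        rw [hsplit, Finset.sum_const, Finset.card_univ, Fintype.card_fun, Fintype.card_bool,
          Fintype.card_fin, nsmul_eq_mul, ENNReal.ofReal_pow zero_le_two]
        simp

/-- In a space with cells of all sizes, the uniform measure is the Hausdorff measure: it is at most
the Hausdorff measure, and the two agree on cells. -/
lemma eq_hausdorffMeasure (h : UniformUpTo μ Set.univ) {δ : ℝ} {o : X}
    (hC : ∀ k : ℤ, IsCell (2 ^ k * δ) (closure (ball o (2 ^ k * δ)))) : μ = μH[1] := by
  have hδ : 0 < δ := by simpa using (hC 0).pos
  have hcell : ∀ N : ℕ, μ (closure (ball o (2 ^ N * δ))) = ENNReal.ofReal (2 ^ N * δ) := by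
    intro N
    have := (hC N).measure_eq h
    rwa [zpow_natCast] at this
  refine Measure.ext_of_iUnion_eq_univ (s := fun N : ℕ => closure (ball o (2 ^ N * δ)))
    (Set.eq_univ_of_forall fun x =>
      Set.mem_iUnion.2 (exists_mem_closure_ball_two_pow hδ o x)) fun N => ?_
  have : IsFiniteMeasure (μ.restrict (closure (ball o (2 ^ N * δ)))) :=
    ⟨by rw [Measure.restrict_apply_univ, hcell]; exact ENNReal.ofReal_lt_top⟩
  have : IsFiniteMeasure ((μH[1] : Measure X).restrict (closure (ball o (2 ^ N * δ)))) :=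
    ⟨by
      rw [Measure.restrict_apply_univ]
      exact (hausdorffMeasure_cell_le h hC N).trans_lt ENNReal.ofReal_lt_top⟩
  refine Measure.eq_of_le_of_measure_univ_eq
    (Measure.restrict_mono le_rfl h.le_hausdorffMeasure) ?_
  rw [Measure.restrict_apply_univ, Measure.restrict_apply_univ]
  refine le_antisymm (h.le_hausdorffMeasure _) ?_
  rw [hcell]
  exact hausdorffMeasure_cell_le h hC N

end HausdorffMeasure

/-! ### The classification -/

section Classification

variable {X : Type*} [MetricSpace X] [ProperSpace X] [MeasurableSpace X] [BorelSpace X]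
  {μ : Measure X}

/-- A connected cell is a circle. -/
lemma IsCell.exists_equiv_addCircle {ρ : ℝ} {C : Set X} (hC : IsCell ρ C)
    (h : UniformUpTo μ Set.univ) (hconn : IsConnected C) :
    ∃ e : C ≃ AddCircle (2 : ℝ), ∀ p q, dist p q = ρ * dist (e p) (e q) := by
  have : ConnectedSpace C := isConnected_iff_connectedSpace.1 hconn
  have : CompactSpace C := isCompact_iff_compactSpace.1
    (Metric.isCompact_of_isClosed_isBounded hC.isClosed hC.isBounded)
  have hemb : MeasurableEmbedding (Subtype.val : C → X) :=
    MeasurableEmbedding.subtype_coe hC.isOpen.measurableSet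
  have hunif : UniformUpTo (μ.comap (Subtype.val : C → X)) (Set.Iio ρ) := by
    refine ⟨isOpen_Iio, isLowerSet_Iio ρ, hC.pos, fun x r hr hrρ => ?_⟩
    rw [hemb.comap_apply, ← h.measure_ball x.1 r hr (Set.mem_univ _)]
    congr 1
    ext z
    constructor
    · rintro ⟨w, hw, rfl⟩
      exact hw
    · intro hz
      exact ⟨⟨z, hC.ball_subset x.1 x.2 (ball_subset_ball (le_of_lt hrρ) hz)⟩, hz, rfl⟩
  refine hunif.exists_equiv_addCircle hC.pos (fun p q => hC.dist_le p.2 q.2) ?_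
  rw [hemb.comap_apply, Set.image_univ, Subtype.range_coe, hC.measure_eq h]

lemma isScaledCopy_circleMeasure (h : UniformUpTo μ Set.univ) {ρ : ℝ} {o : X}
    (hC : IsCell ρ (closure (ball o ρ))) (hconn : IsConnected (closure (ball o ρ))) :
    IsScaledCopy μ circleMeasure := by
  obtain ⟨e₁, he₁⟩ := hC.exists_equiv_addCircle h hconn
  obtain ⟨e₂, he₂⟩ := hC.exists_equiv_prod h
  set e : CircleSpace ≃ X :=
    { toFun := fun p => e₂.symm (e₁.symm p.pt, p.seq)
      invFun := fun x => ⟨e₁ (e₂ x).1, (e₂ x).2⟩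
      left_inv := fun p => by simp
      right_inv := fun x => by simp } with he
  have hdist : ∀ p q, dist (e p) (e q) = ρ * dist p q := by
    intro p q
    change dist (e₂.symm (e₁.symm p.pt, p.seq)) (e₂.symm (e₁.symm q.pt, q.seq)) = _
    rw [he₂, e₂.apply_symm_apply, e₂.apply_symm_apply, he₁, e₁.apply_symm_apply,
      e₁.apply_symm_apply, CircleSpace.dist_def, mul_add]
  exact ⟨ρ, hC.pos, e, hdist, eq_smul_map_of_measure_ball h hC.pos hdist one_half_pos
    fun p r hr hr' => circleMeasure_ball p hr hr'⟩

lemma isScaledCopy_dyadicMeasure (h : UniformUpTo μ Set.univ) {δ : ℝ} {o : X}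
    (hC : ∀ k : ℤ, IsCell (2 ^ k * δ) (closure (ball o (2 ^ k * δ)))) :
    IsScaledCopy μ dyadicMeasure := by
  have hδ : 0 < δ := by simpa using (hC 0).pos
  obtain ⟨e, he⟩ := exists_equiv_dyadicSpace h hC
  refine ⟨δ, hδ, e, he, ?_⟩
  rw [eq_hausdorffMeasure h hC]
  exact hausdorffMeasure_eq_smul_map hδ he

lemma map_eq_lineMeasure (h : UniformUpTo μ Set.univ) (e : X ≃ᵢ ℝ) : μ.map e = lineMeasure := by
  have h1 := eq_smul_map_of_measure_ball (c := 1) (e := e.symm.toEquiv) (ν := lineMeasure) h one_pos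
    (fun p q => by rw [one_mul]; exact e.symm.dist_eq p q) one_pos
    fun p r _ _ => lineMeasure_ball p r
  rw [h1, ENNReal.ofReal_one, one_smul]
  change Measure.map e (Measure.map e.symm lineMeasure) = lineMeasure
  rw [Measure.map_map e.continuous.measurable e.symm.continuous.measurable]
  have : (e ∘ e.symm : ℝ → ℝ) = id := funext e.apply_symm_apply
  rw [this, Measure.map_id]

lemma isScaledCopy_lineMeasure (h : UniformUpTo μ Set.univ) (e : X ≃ᵢ ℝ) :
    IsScaledCopy μ lineMeasure := by
  have hdist : ∀ p q : ℝ, dist (e.symm.toEquiv p) (e.symm.toEquiv q) = 1 * dist p q :=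
    fun p q => by rw [one_mul]; exact e.symm.dist_eq p q
  exact ⟨1, one_pos, e.symm.toEquiv, hdist, eq_smul_map_of_measure_ball h one_pos hdist one_pos
    fun p r _ _ => lineMeasure_ball p r⟩

end Classification

/-- Classification of 1-uniform metric measure spaces. -/
theorem theorem1p2 {X : Type*} [MetricSpace X] [CompleteSpace X] [Nonempty X]
    [MeasurableSpace X] [BorelSpace X] (μ : Measure X) (hμ : IsOneUniform μ) :
    -- the classification
    (IsScaledCopy μ lineMeasure ∨ IsScaledCopy μ dyadicMeasure ∨ IsScaledCopy μ circleMeasure) ∧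
    -- a connected space is the line
    (ConnectedSpace X → ∃ e : X ≃ᵢ ℝ, μ.map e = lineMeasure) ∧
    -- a disconnected space has a Besicovitch pair
    (¬ ConnectedSpace X → ∃ a b : X, IsBesicovitchPair a b) ∧
    -- every Besicovitch pair splits the space
    (∀ a b : X, IsBesicovitchPair a b →
      ∃ e : X ≃ closure (ball a (dist a b)) × BinarySeq, ∀ x y : X,
        dist x y = dist (e x).1 (e y).1 + dist a b * dist (e x).2 (e y).2) := by
  have h := hμ.uniformUpTo
  have : ProperSpace X := h.properSpace
  have hpre : ¬ ConnectedSpace X → ¬ PreconnectedSpace X := fun hX hX' => hX { toNonempty := ‹_› }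
  refine ⟨?_, fun hX => ?_, fun hX => exists_isBesicovitchPair h (hpre hX),
    fun a b hab => (hab.isCell h).exists_equiv_prod h⟩
  · by_cases hX : ConnectedSpace X
    · obtain ⟨e⟩ := h.nonempty_isometryEquiv_real
      exact Or.inl (isScaledCopy_lineMeasure h e)
    · rcases exists_connected_cell_or_forall_cell h (hpre hX) with ⟨ρ, o, hC, hconn⟩ | ⟨δ, o, hC⟩
      · exact Or.inr (Or.inr (isScaledCopy_circleMeasure h hC hconn))
      · exact Or.inr (Or.inl (isScaledCopy_dyadicMeasure h hC))
  · obtain ⟨e⟩ := h.nonempty_isometryEquiv_real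
    exact ⟨e, map_eq_lineMeasure h e⟩
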